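/- Let $\mathfrak g$ be a complex basic classical Lie superalgebra (finite dimensional, simple, with $\mathfrak g_{\bar 1}$ completely reducible over $\mathfrak g_{\bar 0}$, and with a non-degenerate consistent supersymmetric invariant bilinear form), and let $\Gamma$ be a finite group acting on $\mathfrak g$ by automorphisms such that the fixed point subalgebra $\mathfrak g^\Gamma$ is again a basic classical Lie superalgebra. Fix a Cartan subalgebra $\mathfrak h_\Gamma$ of the even part $\mathfrak g^\Gamma_{\bar 0}$ and a triangular decomposition $\mathfrak g^\Gamma=\mathfrak n^-_\Gamma\oplus\mathfrak h_\Gamma\oplus\mathfrak n^+_\Gamma$ given by a set $\Delta$ of simple roots (linearly independent roots of $\mathfrak g^\Gamma$ such that each root is a nonnegative integral combination of $\Delta$ or the negative of one), where $\mathfrak n^{\pm}_\Gamma$ is the sum of the root spaces of the positive, respectively negative, roots. Let $R_{\bar 0}^+$ be the set of positive roots of the Lie algebra $\mathfrak g^\Gamma_{\bar 0}$, and let $\Pi_{\bar 0}$ be the set of simple roots of $\mathfrak g^\Gamma_{\bar 0}$ for $R_{\bar 0}^+$, i.e. the elements of $R_{\bar 0}^+$ that are not sums of two elements of $R_{\bar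 0}^+$. For $\alpha\in\Pi_{\bar 0}$ choose root vectors $x_\alpha\in(\mathfrak g^\Gamma_{\bar 0})_{\alpha}$ and $x_\alpha^-\in(\mathfrak g^\Gamma_{\bar 0})_{-\alpha}$ such that $h_\alpha=[x_\alpha,x_\alpha^-]\in\mathfrak h_\Gamma$ satisfies $\alpha(h_\alpha)=2$. Let $\Lambda^+\subset\mathfrak h_\Gamma^*$ be the set of all $\lambda$ for which the irreducible $\mathfrak g^\Gamma$-supermodule of highest weight $\lambda$ is finite dimensional. For $\lambda\in\Lambda^+$, let $\bar V(\lambda)$ be the $\mathfrak g^\Gamma$-module generated by a vector $v_\lambda$ with defining relations $$\mathfrak n^+_\Gamma v_\lambda=0,\qquad h v_\lambda=\lambda(h)v_\lambda\ \ (h\in\mathfrak h_\Gamma),\qquad (x_\alpha^-)^{\lambda(h_\alpha)+1}v_\lambda=0\ \ (\alpha\in\Pi_{\bar 0}).$$ Then, for every $\lambda\in\Lambda^+$, the module $\bar V(\lambda)$ is finite dimensional. -/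

import Mathlib

/-- The sign `(-1)^{|x||y|}` for homogeneous elements of parities `i` and `j`. -/
def superSign (i j : ZMod 2) : ℂ := (-1) ^ (i.val * j.val)

/-- A complex Lie superalgebra: a vector space with a `ℤ/2`-grading `L = gr 0 ⊕ gr 1` and a bilinear
bracket `sbr` which respects the grading and satisfies skew-supersymmetry and the super Jacobi
identity. -/
class LieSuperalgebra (L : Type*) [AddCommGroup L] [Module ℂ L] where
  gr : ZMod 2 → Submodule ℂ L
  isCompl_gr : IsCompl (gr 0) (gr 1)
  sbr : L →ₗ[ℂ] L →ₗ[ℂ] L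
  sbr_mem : ∀ {i j : ZMod 2} {x y : L}, x ∈ gr i → y ∈ gr j → sbr x y ∈ gr (i + j)
  sbr_skew : ∀ {i j : ZMod 2} {x y : L}, x ∈ gr i → y ∈ gr j →
    sbr x y = -(superSign i j • sbr y x)
  sbr_jacobi : ∀ {i j k : ZMod 2} {x y z : L}, x ∈ gr i → y ∈ gr j → z ∈ gr k →
    sbr x (sbr y z) = sbr (sbr x y) z + superSign i j • sbr y (sbr x z)

namespace LieSuperalgebra

section Basic

variable (L : Type*) [AddCommGroup L] [Module ℂ L] [LieSuperalgebra L]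

/-- The even part, as a type; it is a Lie algebra. -/
abbrev Even : Type _ := ↥(gr (L := L) 0)

/-- The odd part, as a type; it is a module over the even part. -/
abbrev Odd : Type _ := ↥(gr (L := L) 1)

variable {L}

theorem sbr_even_mem {i : ZMod 2} {x y : L} (hx : x ∈ gr (L := L) 0) (hy : y ∈ gr (L := L) i) :
    sbr x y ∈ gr (L := L) i := by
  simpa using sbr_mem hx hy

theorem sbr_even_self {x : L} (hx : x ∈ gr (L := L) 0) : sbr x x = 0 := by
  have h := sbr_skew hx hx
  simp only [superSign, ZMod.val_zero, mul_zero, pow_zero, one_smul] at h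
  have h2 : (2 : ℂ) • sbr x x = 0 := by
    rw [two_smul]; nth_rewrite 1 [h]; simp
  exact (smul_eq_zero.mp h2).resolve_left two_ne_zero

theorem sbr_even_jacobi {k : ZMod 2} {x y z : L} (hx : x ∈ gr (L := L) 0) (hy : y ∈ gr (L := L) 0)
    (hz : z ∈ gr (L := L) k) : sbr x (sbr y z) = sbr (sbr x y) z + sbr y (sbr x z) := by
  have h := sbr_jacobi hx hy hz
  simpa [superSign] using h

instance evenLieRing : LieRing (Even L) where
  bracket x y := ⟨sbr (x : L) (y : L), sbr_even_mem x.2 y.2⟩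
  add_lie x y z := by ext; simp
  lie_add x y z := by ext; simp
  lie_self x := by ext; exact sbr_even_self x.2
  leibniz_lie x y z := by ext; exact sbr_even_jacobi x.2 y.2 z.2

instance evenLieAlgebra : LieAlgebra ℂ (Even L) where
  lie_smul t x y := by ext; simp [Bracket.bracket]

instance oddLieRingModule : LieRingModule (Even L) (Odd L) where
  bracket x y := ⟨sbr (x : L) (y : L), sbr_even_mem x.2 y.2⟩
  add_lie x y z := by ext; simp
  lie_add x y z := by ext; simp
  leibniz_lie x y z := by ext; exact sbr_even_jacobi x.2 y.2 z.2

instance oddLieModule : LieModule ℂ (Even L) (Odd L) where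
  smul_lie t x y := by ext; simp [Bracket.bracket]
  lie_smul t x y := by ext; simp [Bracket.bracket]

variable (L)

/-- A simple Lie superalgebra: the bracket is not zero, and every graded ideal is `0` or everything. -/
structure IsSimple : Prop where
  nonabelian : ∃ x y : L, sbr x y ≠ 0
  eq_bot_or_eq_top : ∀ I : Submodule ℂ L,
    I ≤ (I ⊓ gr 0) ⊔ (I ⊓ gr 1) → (∀ x ∈ I, ∀ y : L, sbr x y ∈ I) → I = ⊥ ∨ I = ⊤

/-- A basic classical Lie superalgebra: finite-dimensional, simple, with completely reducible
`L_0`-module `L_1`, and carrying a non-degenerate bilinear form which is consistent, supersymmetric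
and invariant. -/
structure IsBasicClassical : Prop where
  finite : Module.Finite ℂ L
  simple : IsSimple L
  classical : ComplementedLattice (LieSubmodule ℂ (Even L) (Odd L))
  basic : ∃ B : LinearMap.BilinForm ℂ L, B.Nondegenerate ∧
    (∀ x ∈ gr (L := L) 0, ∀ y ∈ gr (L := L) 1, B x y = 0 ∧ B y x = 0) ∧
    (∀ (i j : ZMod 2), ∀ x ∈ gr (L := L) i, ∀ y ∈ gr (L := L) j, B x y = superSign i j * B y x) ∧
    (∀ x y z : L, B (sbr x y) z = B x (sbr y z))

/-- The defining relations `[x, y] = x ⊗ y - (-1)^{|x||y|} y ⊗ x` (`x`, `y` homogeneous) of the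
enveloping superalgebra. -/
inductive EnvelopingRel : TensorAlgebra ℂ L → TensorAlgebra ℂ L → Prop
  | rel {i j : ZMod 2} {x y : L} (hx : x ∈ gr (L := L) i) (hy : y ∈ gr (L := L) j) :
      EnvelopingRel (TensorAlgebra.ι ℂ (sbr x y))
        (TensorAlgebra.ι ℂ x * TensorAlgebra.ι ℂ y
          - superSign i j • (TensorAlgebra.ι ℂ y * TensorAlgebra.ι ℂ x))

/-- The universal enveloping superalgebra `U(L)`, as an associative unital algebra. -/
def Enveloping : Type _ := RingQuot (EnvelopingRel L)

noncomputable instance envelopingRing : Ring (Enveloping L) :=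
  inferInstanceAs (Ring (RingQuot (EnvelopingRel L)))

noncomputable instance envelopingAlgebra : Algebra ℂ (Enveloping L) :=
  inferInstanceAs (Algebra ℂ (RingQuot (EnvelopingRel L)))

/-- The canonical map `L → U(L)`. -/
noncomputable def toU : L →ₗ[ℂ] Enveloping L :=
  (RingQuot.mkAlgHom ℂ (EnvelopingRel L)).toLinearMap ∘ₗ TensorAlgebra.ι ℂ

/-- A supermodule over `L`: a `ℤ/2`-graded vector space `V` and an even linear map
`L → End V` with `[x, y] v = x (y v) - (-1)^{|x||y|} y (x v)` for homogeneous `x`, `y`. -/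
structure SuperRep (V : Type*) [AddCommGroup V] [Module ℂ V] where
  vgr : ZMod 2 → Submodule ℂ V
  isCompl_vgr : IsCompl (vgr 0) (vgr 1)
  act : L →ₗ[ℂ] Module.End ℂ V
  act_mem : ∀ {i j : ZMod 2} {x : L} {v : V}, x ∈ gr (L := L) i → v ∈ vgr j → act x v ∈ vgr (i + j)
  act_sbr : ∀ {i j : ZMod 2} {x y : L}, x ∈ gr (L := L) i → y ∈ gr (L := L) j → ∀ v : V,
    act (sbr x y) v = act x (act y v) - superSign i j • act y (act x v)

variable {L}

/-- An irreducible supermodule: nonzero, with no graded submodules besides `0` and itself. -/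
structure SuperRep.IsIrreducible {V : Type*} [AddCommGroup V] [Module ℂ V] (ρ : SuperRep L V) :
    Prop where
  nontrivial : Nontrivial V
  eq_bot_or_eq_top : ∀ W : Submodule ℂ V,
    W ≤ (W ⊓ ρ.vgr 0) ⊔ (W ⊓ ρ.vgr 1) → (∀ x : L, ∀ w ∈ W, ρ.act x w ∈ W) → W = ⊥ ∨ W = ⊤

end Basic

section Roots

variable {L : Type*} [AddCommGroup L] [Module ℂ L] [LieSuperalgebra L]

/-- The space `L^α = {x | [h, x] = α(h) x for all h ∈ 𝔥}`, for `𝔥` a subalgebra of the even part. -/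
def rootSpace (𝔥 : LieSubalgebra ℂ (Even L)) (α : Module.Dual ℂ 𝔥) : Submodule ℂ L where
  carrier := {x | ∀ h : 𝔥, sbr ((h : Even L) : L) x = α h • x}
  add_mem' := by
    intro x y hx hy h
    rw [map_add, hx h, hy h, smul_add]
  zero_mem' := by intro h; simp
  smul_mem' := by
    intro c x hx h
    rw [map_smul, hx h, smul_comm]

/-- The roots `R` of `L` with respect to `𝔥`. -/
def roots (𝔥 : LieSubalgebra ℂ (Even L)) : Set (Module.Dual ℂ 𝔥) :=
  {α | α ≠ 0 ∧ rootSpace 𝔥 α ≠ ⊥}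

/-- The even roots: the roots of the Lie algebra `L_0` with respect to `𝔥`. -/
def evenRoots (𝔥 : LieSubalgebra ℂ (Even L)) : Set (Module.Dual ℂ 𝔥) :=
  {α | α ≠ 0 ∧ rootSpace 𝔥 α ⊓ gr 0 ≠ ⊥}

/-- The positive roots `R ∩ ℕΔ` defined by a set `Δ` of simple roots. -/
def posRoots (𝔥 : LieSubalgebra ℂ (Even L)) (Δ : Set (Module.Dual ℂ 𝔥)) :
    Set (Module.Dual ℂ 𝔥) :=
  {α | α ∈ roots 𝔥 ∧ α ∈ AddSubmonoid.closure Δ}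

/-- The span of the positive root spaces. -/
def nPos (𝔥 : LieSubalgebra ℂ (Even L)) (Δ : Set (Module.Dual ℂ 𝔥)) : Submodule ℂ L :=
  ⨆ α ∈ posRoots 𝔥 Δ, rootSpace 𝔥 α

/-- The span of the negative root spaces. -/
def nNeg (𝔥 : LieSubalgebra ℂ (Even L)) (Δ : Set (Module.Dual ℂ 𝔥)) : Submodule ℂ L :=
  ⨆ α ∈ posRoots 𝔥 Δ, rootSpace 𝔥 (-α)

/-- `𝔥`, as a subspace of `L`. -/
def cartanSubmodule (𝔥 : LieSubalgebra ℂ (Even L)) : Submodule ℂ L :=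
  𝔥.toSubmodule.map (gr (L := L) 0).subtype

variable (L)

/-- A triangular decomposition `L = 𝔫⁻ ⊕ 𝔥 ⊕ 𝔫⁺`: a Cartan subalgebra `𝔥` of `L_0` and a set `Δ` of
simple roots (linearly independent roots such that each root lies in `ℕΔ` or in `-ℕΔ`), for which
`L` is the direct sum of `𝔥` and the spans `𝔫⁺`, `𝔫⁻` of the positive and negative root spaces. -/
structure Triangular where
  𝔥 : LieSubalgebra ℂ (Even L)
  isCartan : 𝔥.IsCartanSubalgebra
  Δ : Set (Module.Dual ℂ 𝔥)
  Δ_subset : Δ ⊆ roots 𝔥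
  linearIndependent : LinearIndepOn ℂ id Δ
  pos_or_neg : ∀ α ∈ roots 𝔥, α ∈ AddSubmonoid.closure Δ ∨ -α ∈ AddSubmonoid.closure Δ
  isInternal : DirectSum.IsInternal ![nNeg 𝔥 Δ, cartanSubmodule 𝔥, nPos 𝔥 Δ]

variable {L}

namespace Triangular

variable (T : Triangular L)

/-- The positive even roots `R_0⁺`. -/
def posEvenRoots : Set (Module.Dual ℂ T.𝔥) := evenRoots T.𝔥 ∩ posRoots T.𝔥 T.Δ

/-- The simple roots of the Lie algebra `L_0` for the positive system `R_0⁺`: those elements of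
`R_0⁺` which are not a sum of two elements of `R_0⁺`. -/
def evenSimpleRoots : Set (Module.Dual ℂ T.𝔥) :=
  {α | α ∈ T.posEvenRoots ∧ ∀ β ∈ T.posEvenRoots, ∀ γ ∈ T.posEvenRoots, α ≠ β + γ}

/-- `x ∈ (L_0)^α` and `y ∈ (L_0)^{-α}` are root vectors, normalised so that `h = [x, y]` lies in `𝔥`
and is the coroot `h_α`, i.e. `α(h) = 2`. -/
structure IsRootTriple (α : Module.Dual ℂ T.𝔥) (x y : L) (h : T.𝔥) : Prop where
  pos_mem : x ∈ rootSpace T.𝔥 α ⊓ gr 0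
  neg_mem : y ∈ rootSpace T.𝔥 (-α) ⊓ gr 0
  sbr_eq : sbr x y = ((h : Even L) : L)
  apply_eq_two : α h = 2

/-- `v` is a highest weight vector of weight `lam`. -/
structure IsHighestWeightVector {V : Type*} [AddCommGroup V] [Module ℂ V] (ρ : SuperRep L V)
    (lam : Module.Dual ℂ T.𝔥) (v : V) : Prop where
  ne_zero : v ≠ 0
  nPos_act : ∀ x ∈ nPos T.𝔥 T.Δ, ρ.act x v = 0
  cartan_act : ∀ h : T.𝔥, ρ.act ((h : Even L) : L) v = lam h • v

/-- The set `Λ⁺` of weights `lam` for which the irreducible supermodule of highest weight `lam` is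
finite-dimensional. -/
def dominantWeights : Set (Module.Dual ℂ T.𝔥) :=
  {lam | ∃ (V : Type) (_ : AddCommGroup V) (_ : Module ℂ V) (ρ : SuperRep L V),
    ρ.IsIrreducible ∧ (∃ v : V, T.IsHighestWeightVector ρ lam v) ∧ Module.Finite ℂ V}

/-- The left ideal of `U(L)` generated by `𝔫⁺`, by `h - lam(h)` for `h ∈ 𝔥`, and by
`(x_α⁻)^{lam(h_α) + 1}` for the simple roots `α` of `L_0`. -/
noncomputable def vbarIdeal (lam : Module.Dual ℂ T.𝔥) : Submodule (Enveloping L) (Enveloping L) :=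
  Submodule.span (Enveloping L)
    ({u | ∃ x ∈ nPos T.𝔥 T.Δ, u = toU L x} ∪
     {u | ∃ h : T.𝔥, u = toU L ((h : Even L) : L) - algebraMap ℂ (Enveloping L) (lam h)} ∪
     {u | ∃ α ∈ T.evenSimpleRoots, ∃ (x y : L) (h : T.𝔥) (n : ℕ),
        T.IsRootTriple α x y h ∧ lam h = n ∧ u = toU L y ^ (n + 1)})

/-- The `L`-module `V̄(lam)` generated by one vector `v` (the class of `1`) with defining relations
`𝔫⁺ v = 0`, `h v = lam(h) v` and `(x_α⁻)^{lam(h_α) + 1} v = 0` for the simple roots `α` of `L_0`. -/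
abbrev Vbar (lam : Module.Dual ℂ T.𝔥) : Type _ := Enveloping L ⧸ T.vbarIdeal lam

end Triangular

end Roots

section Fixed

/-- An action of a group on a Lie superalgebra by automorphisms. -/
structure GroupAction (Γ : Type*) [Group Γ] (L : Type*) [AddCommGroup L] [Module ℂ L]
    [LieSuperalgebra L] where
  aut : Γ →* (L ≃ₗ[ℂ] L)
  aut_mem : ∀ (γ : Γ) {i : ZMod 2} {x : L}, x ∈ gr (L := L) i → aut γ x ∈ gr (L := L) i
  aut_sbr : ∀ (γ : Γ) (x y : L), aut γ (sbr x y) = sbr (aut γ x) (aut γ y)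

variable {Γ : Type*} [Group Γ] {L : Type*} [AddCommGroup L] [Module ℂ L] [LieSuperalgebra L]

/-- The fixed points `L^Γ`. -/
def GroupAction.fixed (A : GroupAction Γ L) : Submodule ℂ L where
  carrier := {x | ∀ γ : Γ, A.aut γ x = x}
  add_mem' := by
    intro x y hx hy γ
    rw [map_add, hx γ, hy γ]
  zero_mem' := by intro γ; simp
  smul_mem' := by
    intro c x hx γ
    rw [map_smul, hx γ]

/-- `L^Γ` is a Lie superalgebra, with the grading and bracket of `L`. -/
instance fixedLieSuperalgebra (A : GroupAction Γ L) : LieSuperalgebra A.fixed where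
  gr i := (gr (L := L) i).comap A.fixed.subtype
  isCompl_gr := by
    have hc := isCompl_gr (L := L)
    constructor
    · rw [Submodule.disjoint_def]
      intro x h0 h1
      exact Subtype.ext (Submodule.disjoint_def.mp hc.disjoint _ h0 h1)
    · rw [codisjoint_iff, eq_top_iff]
      rintro ⟨x, hx⟩ -
      obtain ⟨a, ha, b, hb, rfl⟩ := Submodule.mem_sup.mp
        (hc.sup_eq_top ▸ (Submodule.mem_top : x ∈ (⊤ : Submodule ℂ L)))
      have key : ∀ γ, A.aut γ a = a ∧ A.aut γ b = b := by
        intro γ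
        have h1 := hx γ
        rw [map_add] at h1
        have h2 : A.aut γ a - a = b - A.aut γ b := by
          rw [sub_eq_sub_iff_add_eq_add, h1, add_comm]
        have h3 : A.aut γ a - a = 0 :=
          Submodule.disjoint_def.mp hc.disjoint _
            (Submodule.sub_mem _ (A.aut_mem γ ha) ha)
            (h2 ▸ Submodule.sub_mem _ hb (A.aut_mem γ hb))
        exact ⟨sub_eq_zero.mp h3, (sub_eq_zero.mp (h2 ▸ h3)).symm⟩
      exact Submodule.mem_sup.mpr ⟨⟨a, fun γ => (key γ).1⟩, ha, ⟨b, fun γ => (key γ).2⟩, hb, rfl⟩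
  sbr := LinearMap.mk₂ ℂ
    (fun x y => ⟨sbr (x : L) (y : L), fun γ => by rw [A.aut_sbr, x.2 γ, y.2 γ]⟩)
    (by intro x x' y; ext; simp) (by intro c x y; ext; simp)
    (by intro x y y'; ext; simp) (by intro c x y; ext; simp)
  sbr_mem := fun hx hy => sbr_mem (L := L) hx hy
  sbr_skew := fun hx hy => Subtype.ext (sbr_skew (L := L) hx hy)
  sbr_jacobi := fun hx hy hz => Subtype.ext (sbr_jacobi (L := L) hx hy hz)

end Fixed

end LieSuperalgebra

/-! Write `L` for the fixed point superalgebra. `L` has finite dimension and `V̄(lam)` is cyclic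
over it, so a PBW-type argument applies: if `L` is spanned by even elements acting locally finitely
together with odd elements, whose squares are half their superbrackets, then sorted words in these
operators applied to the generator span a finite-dimensional space (`finite_of_cyclic`,
`IsSuperAction.finite_of_even_le`).

It remains to see that the span `F` of the locally finite even elements is all of `L_0`. It contains
the Cartan subalgebra and the positive even root spaces, because of how they act on the generator.
If `e` acts locally nilpotently on `V` and on `L`, then `exp(s e)` conjugates locally finite
operators to locally finite ones; reading off the coefficient of `s` gives `[e, F] ⊆ F`
(`IsSuperAction.sbr_mem_locallyFiniteSpan`). This applies to positive even root vectors and, by the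
power relations, to negative simple ones.

Finally `F = L_0` follows without root system theory (`Triangular.even_le_of_stable`). The
orthogonal complement `N` of `F` in `L_0` lies in the positive part and is stable under the same
operators. An element `h₀` measuring heights acts on `L_0` as a sum of brackets of simple root
vectors, so its trace on `N` is zero; its eigenvalues there are positive integers, hence `N = 0`. -/

section LocallyFinite

variable {V : Type*} [AddCommGroup V] [Module ℂ V]

/-- An endomorphism is locally finite if every vector lies in a finite-dimensional stable subspace. -/
def IsLocallyFinite (f : Module.End ℂ V) : Prop :=
  ∀ w : V, ∃ U : Submodule ℂ V, w ∈ U ∧ U.FG ∧ ∀ u ∈ U, f u ∈ U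

/-- An endomorphism is locally nilpotent if every vector is killed by one of its powers. -/
def IsLocallyNilpotent (f : Module.End ℂ V) : Prop := ∀ w : V, ∃ n : ℕ, (f ^ n) w = 0

theorem IsLocallyFinite.exists_fg_of_fg {f : Module.End ℂ V} (hf : IsLocallyFinite f)
    {W : Submodule ℂ V} (hW : W.FG) :
    ∃ U : Submodule ℂ V, W ≤ U ∧ U.FG ∧ ∀ u ∈ U, f u ∈ U := by
  induction W, hW using Submodule.fg_induction with
  | singleton x =>
    obtain ⟨U, h1, h2, h3⟩ := hf x
    exact ⟨U, by simpa using h1, h2, h3⟩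
  | sup N₁ N₂ h₁ h₂ ih₁ ih₂ =>
    obtain ⟨U, h1, h2, h3⟩ := ih₁
    obtain ⟨U', h1', h2', h3'⟩ := ih₂
    refine ⟨U ⊔ U', sup_le_sup h1 h1', h2.sup h2', fun u hu => ?_⟩
    obtain ⟨a, ha, b, hb, rfl⟩ := Submodule.mem_sup.mp hu
    rw [map_add]
    exact Submodule.add_mem_sup (h3 a ha) (h3' b hb)

theorem pow_apply_eq_zero_of_le {f : Module.End ℂ V} {w : V} {n m : ℕ} (h : (f ^ n) w = 0)
    (hnm : n ≤ m) : (f ^ m) w = 0 := by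
  obtain ⟨k, rfl⟩ := Nat.exists_eq_add_of_le hnm
  rw [add_comm, pow_add, Module.End.mul_apply, h, map_zero]

theorem IsLocallyNilpotent.isLocallyFinite {f : Module.End ℂ V} (hf : IsLocallyNilpotent f) :
    IsLocallyFinite f := by
  intro w
  obtain ⟨n, hn⟩ := hf w
  refine ⟨Submodule.span ℂ ((fun k => (f ^ k) w) '' (Finset.range (n + 1))), ?_, ?_, ?_⟩
  · exact Submodule.subset_span ⟨0, by simp, by simp⟩
  · exact Submodule.fg_span ((Finset.finite_toSet _).image _)
  · intro u hu
    induction hu using Submodule.span_induction with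
    | mem x hx =>
      obtain ⟨k, -, rfl⟩ := hx
      by_cases hk : k + 1 ≤ n
      · refine Submodule.subset_span ⟨k + 1, by simpa using hk, ?_⟩
        simp only [pow_succ', Module.End.mul_apply]
      · have : f ((f ^ k) w) = 0 := by
          rw [← Module.End.mul_apply, ← pow_succ']
          exact pow_apply_eq_zero_of_le hn (by omega)
        rw [this]; exact zero_mem _
    | zero => simp
    | add x y _ _ hx hy => rw [map_add]; exact add_mem hx hy
    | smul c x _ hx => rw [map_smul]; exact Submodule.smul_mem _ _ hx

/-! ### Words in operators and a PBW-type finiteness criterion -/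

/-- The span of the vectors obtained from `v` by fewer than `k` of the operators `b i`. -/
def wordSpan {ι : Type*} (b : ι → Module.End ℂ V) (v : V) (k : ℕ) : Submodule ℂ V :=
  Submodule.span ℂ {w | ∃ l : List ι, l.length < k ∧ (l.map b).prod v = w}

section WordSpan

variable {ι : Type*} {b : ι → Module.End ℂ V} {v : V}

theorem prod_mem_wordSpan {l : List ι} {k : ℕ} (h : l.length < k) :
    (l.map b).prod v ∈ wordSpan b v k :=
  Submodule.subset_span ⟨l, h, rfl⟩

theorem apply_mem_wordSpan (i : ι) {k : ℕ} {w : V} (hw : w ∈ wordSpan b v k) :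
    b i w ∈ wordSpan b v (k + 1) := by
  induction hw using Submodule.span_induction with
  | mem x hx =>
    obtain ⟨l, hl, rfl⟩ := hx
    exact Submodule.subset_span ⟨i :: l, by simpa using hl, by simp⟩
  | zero => simp
  | add x y _ _ hx hy => rw [map_add]; exact add_mem hx hy
  | smul c x _ hx => rw [map_smul]; exact Submodule.smul_mem _ _ hx

theorem span_apply_mem_wordSpan {c : Module.End ℂ V} (hc : c ∈ Submodule.span ℂ (Set.range b))
    {k : ℕ} {w : V} (hw : w ∈ wordSpan b v k) : c w ∈ wordSpan b v (k + 1) := by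
  induction hc using Submodule.span_induction with
  | mem x hx =>
    obtain ⟨i, rfl⟩ := hx
    exact apply_mem_wordSpan i hw
  | zero => simp
  | add x y _ _ hx hy => exact add_mem hx hy
  | smul c x _ hx => exact Submodule.smul_mem _ _ hx

/-- Each transposition of neighbouring letters costs a scalar and an error in which two letters have
become one. Since `wordSpan` uses a strict bound, `wordSpan b v l.length` consists of combinations
of strictly shorter words. -/
theorem perm_sub_mem_wordSpan
    (hcomm : ∀ i j, ∃ ε : ℂ, b i * b j - ε • (b j * b i) ∈ Submodule.span ℂ (Set.range b))
    {l l' : List ι} (h : l.Perm l') :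
    ∃ ε : ℂ, (l.map b).prod v - ε • (l'.map b).prod v ∈ wordSpan b v l.length := by
  induction h with
  | nil => exact ⟨1, by simp⟩
  | cons x _ ih =>
    obtain ⟨ε, h⟩ := ih
    refine ⟨ε, ?_⟩
    have := apply_mem_wordSpan x h
    simpa using this
  | swap x y l =>
    obtain ⟨ε, h⟩ := hcomm y x
    refine ⟨ε, ?_⟩
    have := span_apply_mem_wordSpan h (prod_mem_wordSpan (b := b) (v := v) (Nat.lt_succ_self l.length))
    simpa [mul_assoc] using this
  | trans h₁ h₂ ih₁ ih₂ =>
    obtain ⟨ε₁, h1⟩ := ih₁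
    obtain ⟨ε₂, h2⟩ := ih₂
    refine ⟨ε₁ * ε₂, ?_⟩
    rw [← h₁.length_eq] at h2
    have := add_mem h1 (Submodule.smul_mem _ ε₁ h2)
    rwa [smul_sub, smul_smul, sub_add_sub_cancel] at this

end WordSpan

/-- Induction on `m`, where only the last `m` letters are allowed. The letter added is the least, so
in a sorted word it occurs only at the head. If it is locally finite, `D` is enlarged to a
finite-dimensional stable space; if its square is a combination of letters, two copies give shorter
words, so `D + b i D` suffices. -/
theorem exists_fg_sorted_words {n : ℕ} {b : Fin n → Module.End ℂ V} {v : V}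
    (hfin : ∀ i, IsLocallyFinite (b i) ∨ b i * b i ∈ Submodule.span ℂ (Set.range b)) (m : ℕ) :
    ∃ D : Submodule ℂ V, D.FG ∧ ∀ l : List (Fin n), l.Pairwise (· ≤ ·) →
      (∀ a ∈ l, n ≤ a.val + m) → (l.map b).prod v ∈ D ⊔ wordSpan b v l.length := by
  induction m with
  | zero =>
    refine ⟨Submodule.span ℂ {v}, Submodule.fg_span (Set.finite_singleton v), ?_⟩
    intro l _ hl
    cases l with
    | nil => exact Submodule.mem_sup_left (by simp)
    | cons a l => have := hl a (by simp); omega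
  | succ m ih =>
    obtain ⟨D, hD, hDl⟩ := ih
    by_cases hmn : m + 1 ≤ n
    swap
    · exact ⟨D, hD, fun l h1 h2 => hDl l h1 fun a ha => by omega⟩
    set i : Fin n := ⟨n - (m + 1), by omega⟩ with hi
    obtain hb | hb := hfin i
    · obtain ⟨U, hDU, hU, hst⟩ := hb.exists_fg_of_fg hD
      refine ⟨U, hU, ?_⟩
      intro l
      induction l with
      | nil =>
        intro h1 h2
        exact sup_le_sup_right hDU _ (hDl [] h1 (by simp))
      | cons a l ihl =>
        intro h1 h2
        rw [List.pairwise_cons] at h1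
        by_cases ha : a = i
        · obtain ⟨x, hx, y, hy, hxy⟩ := Submodule.mem_sup.mp
            (ihl h1.2 fun a' ha' => h2 a' (List.mem_cons_of_mem _ ha'))
          rw [List.map_cons, List.prod_cons, Module.End.mul_apply, ← hxy, map_add, ha]
          exact Submodule.add_mem_sup (hst x hx) (apply_mem_wordSpan i hy)
        · refine sup_le_sup_right hDU _ (hDl _ (List.pairwise_cons.mpr h1) ?_)
          have hai : n ≤ a.val + m := by
            have := h2 a (by simp)
            have h3 : a.val ≠ n - (m + 1) := fun h => ha (Fin.ext h)
            omega
          intro a' ha'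
          rcases List.mem_cons.mp ha' with rfl | h
          · exact hai
          · have := Fin.le_def.mp (h1.1 a' h); omega
    · refine ⟨D ⊔ D.map (b i), hD.sup (hD.map _), ?_⟩
      intro l h1 h2
      have key : ∀ l' : List (Fin n), l'.Pairwise (· ≤ ·) → (∀ a ∈ l', n ≤ a.val + (m + 1)) →
          (∃ a t, l' = a :: t ∧ a = i) ∨ ∀ a ∈ l', n ≤ a.val + m := by
        intro l' h1 h2
        cases l' with
        | nil => right; simp
        | cons a t =>
          by_cases ha : a = i
          · exact Or.inl ⟨a, t, rfl, ha⟩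
          · right
            have hai : n ≤ a.val + m := by
              have := h2 a (by simp)
              have h3 : a.val ≠ n - (m + 1) := fun h => ha (Fin.ext h)
              omega
            intro a' ha'
            rcases List.mem_cons.mp ha' with rfl | h
            · exact hai
            · have := Fin.le_def.mp ((List.pairwise_cons.mp h1).1 a' h); omega
      obtain ⟨a, t, rfl, rfl⟩ | h := key l h1 h2
      · rw [List.pairwise_cons] at h1
        have h2' : ∀ a' ∈ t, n ≤ a'.val + (m + 1) := fun a' ha' => h2 a' (List.mem_cons_of_mem _ ha')
        obtain ⟨c, s, rfl, rfl⟩ | h := key t h1.2 h2'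
        · refine Submodule.mem_sup_right ?_
          have := span_apply_mem_wordSpan hb
            (prod_mem_wordSpan (b := b) (v := v) (Nat.lt_succ_self s.length))
          simpa [mul_assoc] using this
        · obtain ⟨x, hx, y, hy, hxy⟩ := Submodule.mem_sup.mp (hDl t h1.2 h)
          rw [List.map_cons, List.prod_cons, Module.End.mul_apply, ← hxy, map_add]
          exact Submodule.add_mem_sup (Submodule.mem_sup_right ⟨x, hx, rfl⟩)
            (apply_mem_wordSpan _ hy)
      · exact (sup_le_sup_right le_sup_left _ : D ⊔ wordSpan b v l.length ≤ _) (hDl l h1 h)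

/-- A cyclic module over operators which commute up to scalars and lower terms, and which are all
locally finite or of square a combination of the operators, is finite-dimensional. -/
theorem finite_of_cyclic {n : ℕ} {b : Fin n → Module.End ℂ V} {v : V}
    (hcyc : ∀ W : Submodule ℂ V, v ∈ W → (∀ i, ∀ w ∈ W, b i w ∈ W) → W = ⊤)
    (hcomm : ∀ i j, ∃ ε : ℂ, b i * b j - ε • (b j * b i) ∈ Submodule.span ℂ (Set.range b))
    (hfin : ∀ i, IsLocallyFinite (b i) ∨ b i * b i ∈ Submodule.span ℂ (Set.range b)) :
    Module.Finite ℂ V := by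
  obtain ⟨D, hD, hDl⟩ := exists_fg_sorted_words (v := v) hfin n
  have hU : ∀ k, wordSpan b v k ≤ D := by
    intro k
    induction k with
    | zero =>
      refine Submodule.span_le.mpr ?_
      rintro w ⟨l, hl, rfl⟩
      omega
    | succ k ih =>
      refine Submodule.span_le.mpr ?_
      rintro w ⟨l, hl, rfl⟩
      -- Sorting changes the word by a scalar and shorter words, already in `D` by induction; with
      -- `m = n` every letter is allowed in the sorted word.
      obtain ⟨ε, hε⟩ := perm_sub_mem_wordSpan (v := v) hcomm
        (List.mergeSort_perm l (fun x y => decide (x ≤ y))).symm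
      have h1 : wordSpan b v l.length ≤ D := by
        refine le_trans (Submodule.span_mono ?_) ih
        rintro w ⟨l', hl', rfl⟩
        exact ⟨l', by omega, rfl⟩
      have h2 := hDl _ (List.sortedLE_mergeSort (l := l)).pairwise (fun a _ => by omega)
      rw [List.length_mergeSort, sup_eq_left.mpr h1] at h2
      have := add_mem (h1 hε) (D.smul_mem ε h2)
      simpa using this
  have htop : D = ⊤ := by
    rw [eq_top_iff, ← hcyc (⨆ k, wordSpan b v k)]
    · exact iSup_le hU
    · exact Submodule.mem_iSup_of_mem 1 (prod_mem_wordSpan (l := []) (by simp))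
    · intro i w hw
      induction hw using Submodule.iSup_induction' with
      | mem k x hx => exact Submodule.mem_iSup_of_mem (k + 1) (apply_mem_wordSpan i hx)
      | zero => simp
      | add x y _ _ hx hy => rw [map_add]; exact add_mem hx hy
  exact ⟨htop ▸ hD⟩

/-! ### Exponentials and conjugation of locally finite operators -/

/-- The exponential of a locally nilpotent endomorphism. -/
noncomputable def lexp (e : Module.End ℂ V) (he : IsLocallyNilpotent e) : Module.End ℂ V :=
  have hfin : ∀ w : V, (Function.support fun m : ℕ => ((m.factorial : ℂ)⁻¹) • (e ^ m) w).Finite := by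
    intro w
    obtain ⟨n, hn⟩ := he w
    refine (Finset.finite_toSet (Finset.range n)).subset fun m hm => ?_
    by_contra h
    exact hm (by simp [pow_apply_eq_zero_of_le hn (by simpa using h)])
  { toFun := fun w => ∑ᶠ m : ℕ, ((m.factorial : ℂ)⁻¹) • (e ^ m) w
    map_add' := fun w w' => by
      rw [← finsum_add_distrib (hfin w) (hfin w')]
      simp
    map_smul' := fun c w => by
      rw [RingHom.id_apply, smul_finsum' c (hfin w)]
      simp [smul_comm c] }

theorem lexp_apply {e : Module.End ℂ V} (he : IsLocallyNilpotent e) {w : V} {n : ℕ}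
    (hn : (e ^ n) w = 0) :
    lexp e he w = ∑ m ∈ Finset.range n, ((m.factorial : ℂ)⁻¹) • (e ^ m) w := by
  refine finsum_eq_sum_of_support_subset _ fun m hm => ?_
  by_contra h
  exact hm (by simp [pow_apply_eq_zero_of_le hn (by simpa using h)])

/-- `exp(e) w - w` is killed by a smaller power of `e` than `w` is, so induction on that power puts
`w` in the range. -/
theorem lexp_surjective {e : Module.End ℂ V} (he : IsLocallyNilpotent e) :
    Function.Surjective (lexp e he) := by
  suffices h : ∀ n w, (e ^ n) w = 0 → w ∈ LinearMap.range (lexp e he) by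
    intro w
    obtain ⟨n, hn⟩ := he w
    exact h n w hn
  intro n
  induction n with
  | zero => intro w hw; rw [show w = 0 by simpa using hw]; exact zero_mem _
  | succ n ih =>
    intro w hw
    have h : (e ^ n) (lexp e he w - w) = 0 := by
      rw [lexp_apply he hw, Finset.sum_range_succ']
      simp only [Nat.factorial_zero, Nat.cast_one, inv_one, pow_zero, Module.End.one_apply, one_smul,
        add_sub_cancel_right, map_sum, map_smul]
      refine Finset.sum_eq_zero fun m _ => ?_
      rw [← Module.End.mul_apply, ← pow_add, pow_apply_eq_zero_of_le hw (by omega), smul_zero]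
    have := sub_mem (LinearMap.mem_range_self (lexp e he) w) (ih _ h)
    simpa using this

/-- The operator `x ↦ e x - x e`. -/
def commutatorMap {A : Type*} [Ring A] [Algebra ℂ A] (e : A) : Module.End ℂ A :=
  LinearMap.mulLeft ℂ e - LinearMap.mulRight ℂ e

/-- Left multiplication by `e` is the sum of the commuting operators `commutatorMap e` and right
multiplication by `e`; this is the binomial theorem for them. -/
theorem pow_mul_eq_sum {A : Type*} [Ring A] [Algebra ℂ A] (e x : A) (n : ℕ) :
    e ^ n * x = ∑ p ∈ Finset.HasAntidiagonal.antidiagonal n,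
      (n.choose p.1 : ℂ) • (((commutatorMap e) ^ p.1) x * e ^ p.2) := by
  have h : LinearMap.mulLeft ℂ e = commutatorMap e + LinearMap.mulRight ℂ e := by
    rw [commutatorMap, sub_add_cancel]
  have hc : Commute (commutatorMap e) (LinearMap.mulRight ℂ e) := by
    exact (LinearMap.commute_mulLeft_right e e).sub_left (Commute.refl _)
  have := congrArg (fun f => f x) (hc.add_pow' n)
  simp only [← h, LinearMap.pow_mulLeft, LinearMap.mulLeft_apply, LinearMap.sum_apply] at this
  rw [this]
  refine Finset.sum_congr rfl fun p _ => ?_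
  rw [Nat.cast_smul_eq_nsmul, hc.pow_pow, LinearMap.smul_apply, LinearMap.pow_mulRight,
    Module.End.mul_apply, LinearMap.mulRight_apply]

/-- The identity `exp(e) x = (exp(ad e) x) exp(e)`, with the series for `exp(ad e) x` truncated
where its terms vanish. -/
theorem lexp_intertwine {e x : Module.End ℂ V} (he : IsLocallyNilpotent e) {K : ℕ}
    (hK : ((commutatorMap e) ^ K) x = 0) (w : V) :
    lexp e he (x w) = (∑ k ∈ Finset.range K,
      ((k.factorial : ℂ)⁻¹) • ((commutatorMap e) ^ k) x) (lexp e he w) := by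
  obtain ⟨M, hM⟩ := he w
  set a := commutatorMap e with ha
  have h0 : ∀ n, ((n.factorial : ℂ)⁻¹) • (e ^ n) (x w) = ∑ p ∈ Finset.HasAntidiagonal.antidiagonal n,
      (((p.1.factorial : ℂ)⁻¹) • (a ^ p.1) x) (((p.2.factorial : ℂ)⁻¹) • (e ^ p.2) w) := by
    intro n
    rw [← Module.End.mul_apply, pow_mul_eq_sum, LinearMap.sum_apply, Finset.smul_sum]
    refine Finset.sum_congr rfl fun p hp => ?_
    obtain rfl := Finset.HasAntidiagonal.mem_antidiagonal.mp hp
    simp only [LinearMap.smul_apply, Module.End.mul_apply, map_smul, smul_smul]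
    congr 1
    rw [Nat.cast_choose ℂ (Nat.le_add_right _ _), Nat.add_sub_cancel_left]
    have h1 : ((p.1 + p.2).factorial : ℂ) ≠ 0 := Nat.cast_ne_zero.mpr (Nat.factorial_ne_zero _)
    have h2 : (p.1.factorial : ℂ) ≠ 0 := Nat.cast_ne_zero.mpr (Nat.factorial_ne_zero _)
    have h3 : (p.2.factorial : ℂ) ≠ 0 := Nat.cast_ne_zero.mpr (Nat.factorial_ne_zero _)
    field_simp
  have hz : ∀ p : ℕ × ℕ, ¬ (p.1 < K ∧ p.2 < M) →
      (((p.1.factorial : ℂ)⁻¹) • (a ^ p.1) x) (((p.2.factorial : ℂ)⁻¹) • (e ^ p.2) w) = 0 := by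
    intro p hp
    by_cases h1 : p.1 < K
    · rw [pow_apply_eq_zero_of_le hM (not_lt.mp fun h2 => hp ⟨h1, h2⟩), smul_zero, map_zero]
    · rw [pow_apply_eq_zero_of_le hK (not_lt.mp h1), smul_zero, LinearMap.zero_apply]
  have hN : (e ^ (K + M)) (x w) = 0 := by
    have h1 := h0 (K + M)
    rw [Finset.sum_eq_zero] at h1
    · exact (smul_eq_zero.mp h1).resolve_left
        (inv_ne_zero (Nat.cast_ne_zero.mpr (Nat.factorial_ne_zero _)))
    · intro p hp
      have := Finset.HasAntidiagonal.mem_antidiagonal.mp hp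
      exact hz p (by omega)
  rw [lexp_apply he hN, lexp_apply he hM, LinearMap.sum_apply]
  simp only [h0, map_sum]
  rw [← Finset.sum_product', Finset.sum_sigma']
  -- The triangle `p.1 + p.2 < K + M` and the rectangle `K × M` carry the same nonzero terms.
  refine Finset.sum_bij_ne_zero (fun s _ _ => s.2) ?_ ?_ ?_ ?_
  · rintro ⟨n, p⟩ _ h
    have := not_imp_comm.mp (hz p) h
    simpa using this
  · rintro ⟨n, p⟩ h1 _ ⟨n', p'⟩ h2 _ h
    simp only [Finset.mem_sigma, Finset.HasAntidiagonal.mem_antidiagonal] at h1 h2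
    obtain rfl : p = p' := h
    obtain rfl : n = n' := h1.2.symm.trans h2.2
    rfl
  · rintro p hp h
    simp only [Finset.mem_product, Finset.mem_range] at hp
    exact ⟨⟨p.1 + p.2, p⟩, by simp; omega, h, rfl⟩
  · rintro ⟨n, p⟩ _ _
    rfl

/-- `exp(e)` carries `x`-stable subspaces to subspaces stable under the conjugate of `x`;
surjectivity of `exp(e)` is all that is needed to reach every vector. -/
theorem IsLocallyFinite.exp_conj {e x : Module.End ℂ V} (he : IsLocallyNilpotent e)
    (hx : IsLocallyFinite x) {K : ℕ} (hK : ((commutatorMap e) ^ K) x = 0) :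
    IsLocallyFinite (∑ k ∈ Finset.range K,
      ((k.factorial : ℂ)⁻¹) • ((commutatorMap e) ^ k) x) := by
  intro w
  obtain ⟨w', rfl⟩ := lexp_surjective he w
  obtain ⟨U, h1, h2, h3⟩ := hx w'
  refine ⟨U.map (lexp e he), ⟨w', h1, rfl⟩, h2.map _, ?_⟩
  rintro _ ⟨u, hu, rfl⟩
  rw [← lexp_intertwine he hK]
  exact ⟨x u, h3 u hu, rfl⟩

/-- If a polynomial curve stays in a subspace, so do its coefficients. -/
theorem coeff_mem_of_forall_sum_mem {W : Type*} [AddCommGroup W] [Module ℂ W] (F : Submodule ℂ W)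
    {K : ℕ} (x : ℕ → W) (h : ∀ s : ℂ, ∑ k ∈ Finset.range K, s ^ k • x k ∈ F) {k : ℕ} (hk : k < K) :
    x k ∈ F := by
  by_contra hx
  obtain ⟨φ, h1, h2⟩ := Submodule.exists_le_ker_of_notMem hx
  -- A functional vanishing on `F` but not on `x k` turns the curve into a polynomial with all
  -- values zero, hence the zero polynomial.
  have h3 : (∑ k ∈ Finset.range K, Polynomial.C (φ (x k)) * Polynomial.X ^ k) = 0 := by
    refine Polynomial.funext fun s => ?_
    have := h2 (h s)
    rw [LinearMap.mem_ker, map_sum] at this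
    simpa only [Polynomial.eval_finsetSum, Polynomial.eval_mul, Polynomial.eval_C, Polynomial.eval_pow,
      Polynomial.eval_X, Polynomial.eval_zero, map_smul, smul_eq_mul, mul_comm] using this
  have h4 := congrArg (fun p => p.coeff k) h3
  simp [Polynomial.finsetSum_coeff, Polynomial.coeff_C_mul, Polynomial.coeff_X_pow, hk] at h4
  exact h1 h4

end LocallyFinite

/-! ### Trace lemmas -/

theorem trace_restrict_eq_zero_of_commutators {M ι : Type*} [AddCommGroup M] [Module ℂ M]
    (W : Submodule ℂ M) (s : Finset ι) {f : Module.End ℂ M} {X Y : ι → Module.End ℂ M}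
    (hf : ∀ w ∈ W, f w ∈ W) (hX : ∀ i ∈ s, ∀ w ∈ W, X i w ∈ W) (hY : ∀ i ∈ s, ∀ w ∈ W, Y i w ∈ W)
    (h : ∀ w ∈ W, f w = ∑ i ∈ s, (X i (Y i w) - Y i (X i w))) :
    LinearMap.trace ℂ W (f.restrict hf) = 0 := by
  have key : f.restrict hf = ∑ i ∈ s.attach,
      ((X i).restrict (hX i i.2) * (Y i).restrict (hY i i.2)
        - (Y i).restrict (hY i i.2) * (X i).restrict (hX i i.2)) := by
    ext w
    simp only [LinearMap.restrict_apply, h w w.2, LinearMap.sum_apply, LinearMap.sub_apply,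
      Module.End.mul_apply, Submodule.coe_sum, Submodule.coe_sub]
    exact (Finset.sum_attach s fun i => X i (Y i w) - Y i (X i w)).symm
  rw [key, map_sum]
  refine Finset.sum_eq_zero fun i _ => ?_
  rw [map_sub, LinearMap.trace_mul_comm, sub_self]

/-- Applied to the simple roots, this produces the element of the Cartan subalgebra that measures
heights. -/
theorem exists_apply_eq_one_of_linearIndepOn {M : Type*} [AddCommGroup M] [Module ℂ M]
    [Module.Finite ℂ M] {S : Set (Module.Dual ℂ M)} (hS : LinearIndepOn ℂ id S) :
    ∃ m : M, ∀ δ ∈ S, δ m = 1 := by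
  set b := Module.Basis.extend hS
  set f : Module.Dual ℂ (Module.Dual ℂ M) := b.constr ℂ (fun _ => (1 : ℂ))
  refine ⟨(Module.evalEquiv ℂ M).symm f, fun δ hδ => ?_⟩
  have h1 : f δ = 1 := by
    have := b.constr_basis ℂ (fun _ => (1 : ℂ)) ⟨δ, hS.subset_extend (Set.subset_univ _) hδ⟩
    rwa [Module.Basis.extend_apply_self] at this
  rw [← h1, Module.apply_evalEquiv_symm_apply]

/-- An operator on a nonzero space whose eigenvalues are positive integers has nonzero trace. -/
theorem trace_ne_zero_of_eigenvalues {M : Type*} [AddCommGroup M] [Module ℂ M] [Module.Finite ℂ M]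
    [Nontrivial M] (f : Module.End ℂ M)
    (h : ∀ c, f.HasEigenvalue c → ∃ n : ℕ, 0 < n ∧ c = n) : LinearMap.trace ℂ M f ≠ 0 := by
  have hs := IsAlgClosed.splits f.charpoly
  rw [Module.End.trace_eq_sum_roots_charpoly_of_splits hs]
  have hroot : ∀ c ∈ f.charpoly.roots, ∃ n : ℕ, 0 < n ∧ c = n := fun c hc =>
    h c ((Module.End.hasEigenvalue_iff_isRoot_charpoly f c).mpr (Polynomial.isRoot_of_mem_roots hc))
  have hne : f.charpoly.roots ≠ 0 := by
    obtain ⟨c, hc⟩ := Module.End.exists_eigenvalue f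
    have := (Module.End.hasEigenvalue_iff_isRoot_charpoly f c).mp hc
    intro h0
    have h1 := (Polynomial.mem_roots (f.charpoly_monic.ne_zero)).mpr this
    simp [h0] at h1
  have : ∀ s : Multiset ℂ, (∀ c ∈ s, ∃ n : ℕ, 0 < n ∧ c = n) →
      ∃ n : ℕ, s.sum = n ∧ (s ≠ 0 → 0 < n) := by
    intro s
    induction s using Multiset.induction_on with
    | empty => intro _; exact ⟨0, by simp, by simp⟩
    | cons a s ih =>
      intro hs
      obtain ⟨n, hn, -⟩ := ih fun c hc => hs c (Multiset.mem_cons_of_mem hc)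
      obtain ⟨m, hm, rfl⟩ := hs a (Multiset.mem_cons_self a s)
      exact ⟨m + n, by simp [hn], fun _ => by omega⟩
  obtain ⟨n, hn, hpos⟩ := this _ hroot
  rw [hn]
  exact Nat.cast_ne_zero.mpr (hpos hne).ne'

/-! ### Cartan subalgebra, root spaces and the invariant form -/

namespace LieSuperalgebra

section Structure

variable {L : Type*} [AddCommGroup L] [Module ℂ L] [LieSuperalgebra L]

theorem exists_even_add_odd (z : L) : ∃ a ∈ gr (L := L) 0, ∃ b ∈ gr (L := L) 1, a + b = z :=
  Submodule.mem_sup.mp ((isCompl_gr (L := L)).sup_eq_top ▸ Submodule.mem_top)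

theorem sbr_jacobi_of_even {x y : L} (hx : x ∈ gr (L := L) 0) (hy : y ∈ gr (L := L) 0) (z : L) :
    sbr x (sbr y z) = sbr (sbr x y) z + sbr y (sbr x z) := by
  obtain ⟨a, ha, b, hb, rfl⟩ := exists_even_add_odd z
  simp only [map_add, sbr_even_jacobi hx hy ha, sbr_even_jacobi hx hy hb]
  abel

theorem sbr_skew_of_even {x : L} (hx : x ∈ gr (L := L) 0) (y : L) : sbr x y = -sbr y x := by
  obtain ⟨a, ha, b, hb, rfl⟩ := exists_even_add_odd y
  have h1 := sbr_skew hx ha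
  have h2 := sbr_skew hx hb
  simp only [superSign, ZMod.val_zero, zero_mul, pow_zero, one_smul] at h1 h2
  simp only [map_add, LinearMap.add_apply, h1, h2]
  abel

/-- The even part of a root space. -/
def evenSpace (𝔥 : LieSubalgebra ℂ (Even L)) (α : Module.Dual ℂ 𝔥) : Submodule ℂ L :=
  rootSpace 𝔥 α ⊓ gr 0

theorem sbr_mem_rootSpace {𝔥 : LieSubalgebra ℂ (Even L)} {α β : Module.Dual ℂ 𝔥} {x y : L}
    (hx : x ∈ evenSpace 𝔥 α) (hy : y ∈ rootSpace 𝔥 β) : sbr x y ∈ rootSpace 𝔥 (α + β) := by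
  intro h
  rw [sbr_jacobi_of_even h.1.2 hx.2, hx.1 h, hy h, LinearMap.add_apply, add_smul, map_smul, map_smul,
    LinearMap.smul_apply]

/-- Even elements preserve parity, so the even component of a root vector has the same weight. -/
theorem rootSpace_le_evenSpace_sup (𝔥 : LieSubalgebra ℂ (Even L)) (α : Module.Dual ℂ 𝔥) :
    rootSpace 𝔥 α ≤ evenSpace 𝔥 α ⊔ gr 1 := by
  intro x hx
  obtain ⟨a, ha, b, hb, rfl⟩ := exists_even_add_odd x
  refine Submodule.add_mem_sup ⟨fun h => ?_, ha⟩ hb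
  have h1 := hx h
  rw [map_add, smul_add] at h1
  have h2 : sbr ((h : Even L) : L) a - α h • a = α h • b - sbr ((h : Even L) : L) b := by
    rw [sub_eq_sub_iff_add_eq_add, h1, add_comm]
  refine sub_eq_zero.mp (Submodule.disjoint_def.mp (isCompl_gr (L := L)).disjoint _
    (sub_mem (sbr_even_mem h.1.2 ha) (Submodule.smul_mem _ _ ha)) (h2 ▸ ?_))
  exact sub_mem (Submodule.smul_mem _ _ hb) (sbr_even_mem h.1.2 hb)

/-- A bilinear form whose restriction to the even part is symmetric, non-degenerate and invariant. -/
structure IsEvenForm (B : LinearMap.BilinForm ℂ L) : Prop where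
  symm : ∀ x ∈ gr (L := L) 0, ∀ y ∈ gr (L := L) 0, B x y = B y x
  inv : ∀ x y z : L, B (sbr x y) z = B x (sbr y z)
  nondeg : ∀ x ∈ gr (L := L) 0, (∀ y ∈ gr (L := L) 0, B x y = 0) → x = 0

theorem IsBasicClassical.exists_evenForm (hL : IsBasicClassical L) :
    ∃ B : LinearMap.BilinForm ℂ L, IsEvenForm B := by
  obtain ⟨B, hnd, hcons, hsymm, hinv⟩ := hL.basic
  refine ⟨B, fun x hx y hy => ?_, hinv, fun x hx h => hnd.1 x fun y => ?_⟩
  · simpa [superSign] using hsymm 0 0 x hx y hy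
  · obtain ⟨a, ha, b, hb, rfl⟩ := exists_even_add_odd y
    rw [map_add, h a ha, (hcons x hx b hb).1, add_zero]

theorem IsSimple.eq_zero_of_central (hs : IsSimple L) {z : L} (hz : z ∈ gr (L := L) 0)
    (h : ∀ y, sbr z y = 0) : z = 0 := by
  have hgr : Submodule.span ℂ {z} ≤ (Submodule.span ℂ {z} ⊓ gr 0) ⊔ (Submodule.span ℂ {z} ⊓ gr 1) := by
    refine le_trans ?_ le_sup_left
    rw [Submodule.span_singleton_le_iff_mem]
    exact ⟨Submodule.mem_span_singleton_self z, hz⟩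
  have hideal : ∀ x ∈ Submodule.span ℂ {z}, ∀ y : L, sbr x y ∈ Submodule.span ℂ {z} := by
    intro x hx y
    obtain ⟨c, rfl⟩ := Submodule.mem_span_singleton.mp hx
    simp [h]
  rcases hs.eq_bot_or_eq_top (Submodule.span ℂ {z}) hgr hideal with h1 | h1
  · exact Submodule.span_singleton_eq_bot.mp h1
  · obtain ⟨x, y, hxy⟩ := hs.nonabelian
    obtain ⟨c, rfl⟩ := Submodule.mem_span_singleton.mp (h1 ▸ Submodule.mem_top :
      x ∈ Submodule.span ℂ {z})
    exact absurd (by simp [h]) hxy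

variable (T : Triangular L)

namespace Triangular

theorem sup_eq_top : nNeg T.𝔥 T.Δ ⊔ cartanSubmodule T.𝔥 ⊔ nPos T.𝔥 T.Δ = ⊤ := by
  rw [eq_top_iff, ← T.isInternal.submodule_iSup_eq_top]
  refine iSup_le fun i => ?_
  fin_cases i
  · exact le_sup_left.trans le_sup_left
  · exact le_sup_right.trans le_sup_left
  · exact le_sup_right

variable {T}

theorem apply_lie_eq_zero {α : Module.Dual ℂ T.𝔥} (hα : rootSpace T.𝔥 α ≠ ⊥) (a b : T.𝔥) :
    α ⁅a, b⁆ = 0 := by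
  obtain ⟨x, hx, hx0⟩ := Submodule.exists_mem_ne_zero_of_ne_bot hα
  have h1 := sbr_jacobi_of_even a.1.2 b.1.2 x
  have h2 : sbr (sbr ((a : Even L) : L) ((b : Even L) : L)) x = α ⁅a, b⁆ • x := hx ⁅a, b⁆
  rw [h2, hx a, hx b, map_smul, map_smul, hx a, hx b, smul_comm, right_eq_add] at h1
  exact (smul_eq_zero.mp h1).resolve_right hx0

/-- A nonabelian nilpotent `𝔥` contains a nonzero `z` that is central in `𝔥` and a combination of
brackets. Roots vanish on brackets, so `z` would be central in `L`, contradicting simplicity. -/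
theorem lie_cartan_eq_zero (hs : IsSimple L) (a b : T.𝔥) : ⁅a, b⁆ = 0 := by
  have : LieRing.IsNilpotent T.𝔥 := T.isCartan.nilpotent
  by_contra hab
  have hnt : ¬ LieModule.IsTrivial T.𝔥 T.𝔥 := fun h => hab (h.trivial a b)
  have : Nontrivial T.𝔥 := ⟨⟨_, _, hab⟩⟩
  have := LieModule.nontrivial_lowerCentralSeriesLast ℂ T.𝔥 T.𝔥
  obtain ⟨⟨z, hz⟩, hz0⟩ := exists_ne (0 : LieModule.lowerCentralSeriesLast ℂ T.𝔥 T.𝔥)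
  have h1 := LieModule.lowerCentralSeriesLast_le_max_triv ℂ T.𝔥 T.𝔥 hz
  have h2 := LieModule.lowerCentralSeriesLast_le_of_not_isTrivial ℂ T.𝔥 T.𝔥 hnt hz
  rw [LieModule.mem_maxTrivSubmodule] at h1
  have hα : ∀ α : Module.Dual ℂ T.𝔥, rootSpace T.𝔥 α ≠ ⊥ → α z = 0 := by
    intro α hα
    clear h1 hz0 hz
    rw [LieModule.lowerCentralSeries_succ, ← LieSubmodule.mem_toSubmodule,
      LieSubmodule.lieIdeal_oper_eq_linear_span'] at h2
    induction h2 using Submodule.span_induction with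
    | mem x hx =>
      obtain ⟨c, -, d, -, rfl⟩ := hx
      exact apply_lie_eq_zero hα c d
    | zero => simp
    | add x y _ _ hx hy => rw [map_add, hx, hy, add_zero]
    | smul c x _ hx => rw [map_smul, hx, smul_zero]
  have hroot : ∀ α : Module.Dual ℂ T.𝔥, rootSpace T.𝔥 α ≤ LinearMap.ker (sbr ((z : Even L) : L)) := by
    intro α x hx
    by_cases h : rootSpace T.𝔥 α = ⊥
    · rw [h, Submodule.mem_bot] at hx
      rw [hx]; exact zero_mem _
    · rw [LinearMap.mem_ker, hx z, hα α h, zero_smul]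
  have hall : LinearMap.ker (sbr ((z : Even L) : L)) = ⊤ := by
    rw [eq_top_iff, ← T.sup_eq_top]
    refine sup_le (sup_le (iSup₂_le fun α _ => hroot _) ?_) (iSup₂_le fun α _ => hroot _)
    rintro _ ⟨w, hw, rfl⟩
    have h3 := h1 ⟨w, hw⟩
    rw [← lie_skew, neg_eq_zero] at h3
    exact congrArg (fun t : T.𝔥 => ((t : Even L) : L)) h3
  refine hz0 (Subtype.ext (Subtype.ext (Subtype.ext ?_)))
  exact hs.eq_zero_of_central z.1.2 fun y => LinearMap.mem_ker.mp (hall ▸ Submodule.mem_top)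

theorem cartan_sbr_cartan (hs : IsSimple L) (a b : T.𝔥) :
    sbr ((a : Even L) : L) ((b : Even L) : L) = 0 :=
  congrArg (fun t : T.𝔥 => ((t : Even L) : L)) (lie_cartan_eq_zero hs a b)

theorem cartan_mem_evenSpace (hs : IsSimple L) (a : T.𝔥) :
    ((a : Even L) : L) ∈ evenSpace T.𝔥 0 :=
  ⟨fun h => by rw [cartan_sbr_cartan hs, LinearMap.zero_apply, zero_smul], a.1.2⟩

theorem cartanSubmodule_le (hs : IsSimple L) : cartanSubmodule T.𝔥 ≤ evenSpace T.𝔥 0 := by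
  rintro _ ⟨w, hw, rfl⟩
  exact cartan_mem_evenSpace hs ⟨w, hw⟩

theorem iSup_rootSpace (hs : IsSimple L) : ⨆ α, rootSpace T.𝔥 α = ⊤ := by
  rw [eq_top_iff, ← T.sup_eq_top]
  refine sup_le (sup_le (iSup₂_le fun α _ => ?_) ?_) (iSup₂_le fun α _ => ?_)
  · exact le_iSup (rootSpace T.𝔥) (-α)
  · exact (cartanSubmodule_le hs).trans (inf_le_left.trans (le_iSup (rootSpace T.𝔥) 0))
  · exact le_iSup (rootSpace T.𝔥) α

variable (T) in
theorem even_le : gr (L := L) 0 ≤ (⨆ α ∈ posRoots T.𝔥 T.Δ, evenSpace T.𝔥 (-α)) ⊔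
    cartanSubmodule T.𝔥 ⊔ ⨆ α ∈ posRoots T.𝔥 T.Δ, evenSpace T.𝔥 α := by
  set D := (⨆ α ∈ posRoots T.𝔥 T.Δ, evenSpace T.𝔥 (-α)) ⊔
    cartanSubmodule T.𝔥 ⊔ ⨆ α ∈ posRoots T.𝔥 T.Δ, evenSpace T.𝔥 α with hD
  have hD0 : D ≤ gr 0 := by
    refine sup_le (sup_le (iSup₂_le fun α _ => inf_le_right) ?_) (iSup₂_le fun α _ => inf_le_right)
    rintro _ ⟨w, -, rfl⟩
    exact w.2
  have htop : D ⊔ gr 1 = ⊤ := by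
    rw [eq_top_iff, ← T.sup_eq_top]
    refine sup_le (sup_le (iSup₂_le fun α hα => ?_) ?_) (iSup₂_le fun α hα => ?_)
    · refine (rootSpace_le_evenSpace_sup _ _).trans (sup_le_sup_right ?_ _)
      exact (le_iSup₂ (f := fun α (_ : α ∈ posRoots T.𝔥 T.Δ) => evenSpace T.𝔥 (-α)) α hα).trans
        (le_sup_left.trans le_sup_left)
    · exact (le_sup_right.trans le_sup_left : cartanSubmodule T.𝔥 ≤ D).trans le_sup_left
    · refine (rootSpace_le_evenSpace_sup _ _).trans (sup_le_sup_right ?_ _)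
      exact (le_iSup₂ (f := fun α (_ : α ∈ posRoots T.𝔥 T.Δ) => evenSpace T.𝔥 α) α hα).trans
        le_sup_right
  intro x hx
  obtain ⟨a, ha, b, hb, rfl⟩ := Submodule.mem_sup.mp (htop ▸ Submodule.mem_top : x ∈ D ⊔ gr 1)
  have hb0 : b = 0 := Submodule.disjoint_def.mp (isCompl_gr (L := L)).disjoint _
    (by simpa using sub_mem hx (hD0 ha)) hb
  rwa [hb0, add_zero]

theorem even_le_iSup (hs : IsSimple L) : gr (L := L) 0 ≤ ⨆ α, evenSpace T.𝔥 α := by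
  refine T.even_le.trans (sup_le (sup_le (iSup₂_le fun α _ => ?_) ?_) (iSup₂_le fun α _ => ?_))
  · exact le_iSup (evenSpace T.𝔥) (-α)
  · exact (cartanSubmodule_le hs).trans (le_iSup (evenSpace T.𝔥) 0)
  · exact le_iSup (evenSpace T.𝔥) α

theorem form_eq_zero {B : LinearMap.BilinForm ℂ L} (hB : IsEvenForm B) {α β : Module.Dual ℂ T.𝔥}
    (hαβ : α + β ≠ 0) {x y : L} (hx : x ∈ evenSpace T.𝔥 α) (hy : y ∈ evenSpace T.𝔥 β) :
    B x y = 0 := by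
  obtain ⟨h, hh⟩ := DFunLike.ne_iff.mp hαβ
  have h1 := hB.inv x ((h : Even L) : L) y
  rw [hy.1 h, ← neg_eq_iff_eq_neg.mpr (sbr_skew_of_even h.1.2 x), hx.1 h, map_neg, map_smul,
    map_smul, LinearMap.neg_apply, LinearMap.smul_apply, smul_eq_mul, smul_eq_mul] at h1
  have h2 : (α + β) h * B x y = 0 := by
    rw [LinearMap.add_apply]; linear_combination -h1
  exact (mul_eq_zero.mp h2).resolve_left hh

theorem exists_form_ne_zero (hs : IsSimple L) {B : LinearMap.BilinForm ℂ L} (hB : IsEvenForm B)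
    {α : Module.Dual ℂ T.𝔥} {x : L} (hx : x ∈ evenSpace T.𝔥 α) (hx0 : x ≠ 0) :
    ∃ y ∈ evenSpace T.𝔥 (-α), B x y ≠ 0 := by
  by_contra! hc
  refine hx0 (hB.nondeg x hx.2 fun y hy => ?_)
  have : gr (L := L) 0 ≤ LinearMap.ker (B x) := by
    refine (even_le_iSup (T := T) hs).trans (iSup_le fun β y hy => ?_)
    by_cases h : α + β = 0
    · obtain rfl := (neg_eq_of_add_eq_zero_right h)
      exact hc y hy
    · exact form_eq_zero hB h hx hy
  exact this hy

theorem mem_cartan_of_commute {x : L} (hx : x ∈ gr (L := L) 0)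
    (h : ∀ a : T.𝔥, sbr ((a : Even L) : L) x = 0) : ∃ t : T.𝔥, x = ((t : Even L) : L) := by
  have hmem : (⟨x, hx⟩ : Even L) ∈ T.𝔥 := by
    rw [← T.isCartan.self_normalizing, LieSubalgebra.mem_normalizer_iff]
    intro y hy
    have : ⁅(⟨x, hx⟩ : Even L), y⁆ = 0 := by
      rw [← lie_skew, neg_eq_zero]
      exact Subtype.ext (h ⟨y, hy⟩)
    rw [this]; exact zero_mem _
  exact ⟨⟨_, hmem⟩, rfl⟩

theorem exists_cartan_eq_sbr {B : LinearMap.BilinForm ℂ L} (hB : IsEvenForm B)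
    {α : Module.Dual ℂ T.𝔥} {x y : L} (hx : x ∈ evenSpace T.𝔥 α) (hy : y ∈ evenSpace T.𝔥 (-α)) :
    ∃ t : T.𝔥, sbr x y = ((t : Even L) : L) ∧
      ∀ h : T.𝔥, B ((t : Even L) : L) ((h : Even L) : L) = α h * B x y := by
  obtain ⟨t, ht⟩ := mem_cartan_of_commute (T := T) (sbr_even_mem hx.2 hy.2) fun a => by
    rw [sbr_mem_rootSpace hx hy.1 a]; simp
  refine ⟨t, ht, fun h => ?_⟩
  rw [← ht, hB.inv, ← neg_eq_iff_eq_neg.mpr (sbr_skew_of_even h.1.2 y), hy.1 h]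
  simp

/-- The `x i` and `y i` commute with `t`, so they preserve each eigenspace of `ad t`. There `ad t`
is both a scalar and a sum of commutators, so its trace forces the scalar to be zero. Thus `t` kills
every root space and is central. -/
theorem cartan_eq_zero_of_sum (hL : IsBasicClassical L) {ι : Type*} (s : Finset ι) {x y : ι → L}
    {t : T.𝔥} (hx : ∀ i ∈ s, x i ∈ gr (L := L) 0) (hy : ∀ i ∈ s, y i ∈ gr (L := L) 0)
    (htx : ∀ i ∈ s, sbr ((t : Even L) : L) (x i) = 0)
    (hty : ∀ i ∈ s, sbr ((t : Even L) : L) (y i) = 0)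
    (ht : ((t : Even L) : L) = ∑ i ∈ s, sbr (x i) (y i)) : t = 0 := by
  have := hL.finite
  have hst : ∀ c : ℂ, ∀ z ∈ gr (L := L) 0, sbr ((t : Even L) : L) z = 0 →
      ∀ w ∈ Module.End.eigenspace (sbr ((t : Even L) : L)) c,
        sbr z w ∈ Module.End.eigenspace (sbr ((t : Even L) : L)) c := by
    intro c z hz hz0 w hw
    rw [Module.End.mem_eigenspace_iff] at hw ⊢
    rw [sbr_jacobi_of_even t.1.2 hz, hz0, hw]
    simp
  have hroot : ∀ α : Module.Dual ℂ T.𝔥,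
      rootSpace T.𝔥 α ≤ LinearMap.ker (sbr ((t : Even L) : L)) := by
    intro α w hw
    rw [LinearMap.mem_ker, hw t]
    by_cases hw0 : w = 0
    · rw [hw0, smul_zero]
    set E := Module.End.eigenspace (sbr ((t : Even L) : L)) (α t) with hE
    have hwE : w ∈ E := Module.End.mem_eigenspace_iff.mpr (hw t)
    have hself := hst (α t) _ t.1.2 (sbr_even_self t.1.2)
    have htr := trace_restrict_eq_zero_of_commutators E s
      (X := fun i => sbr (x i)) (Y := fun i => sbr (y i)) hself
      (fun i hi => hst _ _ (hx i hi) (htx i hi)) (fun i hi => hst _ _ (hy i hi) (hty i hi)) ?_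
    · have hsc : (sbr ((t : Even L) : L)).restrict hself = α t • LinearMap.id := by
        ext u
        exact Module.End.mem_eigenspace_iff.mp u.2
      rw [hsc, map_smul, LinearMap.trace_id, smul_eq_mul] at htr
      have : Nontrivial E := ⟨⟨⟨w, hwE⟩, 0, fun h => hw0 (congrArg Subtype.val h)⟩⟩
      rw [(mul_eq_zero.mp htr).resolve_right (Nat.cast_ne_zero.mpr Module.finrank_pos.ne'),
        zero_smul]
    · intro u _
      rw [ht, map_sum, LinearMap.sum_apply]
      refine Finset.sum_congr rfl fun i hi => ?_
      rw [sbr_jacobi_of_even (hx i hi) (hy i hi), add_sub_cancel_right]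
  have hall : LinearMap.ker (sbr ((t : Even L) : L)) = ⊤ := by
    rw [eq_top_iff, ← iSup_rootSpace (T := T) hL.simple]
    exact iSup_le hroot
  exact Subtype.ext (Subtype.ext (hL.simple.eq_zero_of_central t.1.2
    fun y => LinearMap.mem_ker.mp (hall ▸ Submodule.mem_top)))

theorem exists_rootTriple (hL : IsBasicClassical L) {α : Module.Dual ℂ T.𝔥} (hα : α ≠ 0) {y : L}
    (hy : y ∈ evenSpace T.𝔥 (-α)) (hy0 : y ≠ 0) : ∃ x h, T.IsRootTriple α x y h := by
  obtain ⟨B, hB⟩ := hL.exists_evenForm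
  obtain ⟨x, hx, hxy⟩ := exists_form_ne_zero hL.simple hB hy hy0
  rw [neg_neg] at hx
  rw [hB.symm y hy.2 x hx.2] at hxy
  obtain ⟨t, ht, htB⟩ := exists_cartan_eq_sbr hB hx hy
  -- If `α t = 0`, then `t = [x, y]` commutes with `x` and `y`, hence `t = 0`; but `B(t, h) = α(h)
  -- B(x, y)` is not identically zero.
  have h2 : α t ≠ 0 := by
    intro h0
    have : t = 0 := cartan_eq_zero_of_sum hL (Finset.univ : Finset Unit) (x := fun _ => x)
      (y := fun _ => y) (fun _ _ => hx.2) (fun _ _ => hy.2)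
      (fun _ _ => by rw [hx.1 t, h0, zero_smul])
      (fun _ _ => by rw [hy.1 t, LinearMap.neg_apply, h0, neg_zero, zero_smul]) (by simp [ht])
    refine hα (LinearMap.ext fun h => ?_)
    have h3 := htB h
    rw [this] at h3
    simpa [hxy] using h3
  refine ⟨(2 / α t) • x, (2 / α t) • t, Submodule.smul_mem _ _ hx, hy, ?_, ?_⟩
  · simp [ht]
  · rw [map_smul, smul_eq_mul, div_mul_cancel₀ _ h2]

theorem exists_height (hL : IsBasicClassical L) : ∃ h₀ : T.𝔥, ∀ β ∈ posRoots T.𝔥 T.Δ,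
    ∃ n : ℕ, 0 < n ∧ β h₀ = n := by
  have := hL.finite
  have : Module.Finite ℂ T.𝔥 := inferInstanceAs (Module.Finite ℂ T.𝔥.toSubmodule)
  obtain ⟨h₀, hh⟩ := exists_apply_eq_one_of_linearIndepOn T.linearIndependent
  have key : ∀ γ ∈ AddSubmonoid.closure T.Δ, γ = 0 ∨ ∃ n : ℕ, 0 < n ∧ γ h₀ = n := by
    intro γ hγ
    induction hγ using AddSubmonoid.closure_induction with
    | mem x hx => exact Or.inr ⟨1, one_pos, by simpa using hh x hx⟩
    | zero => exact Or.inl rfl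
    | add x y _ _ hx hy =>
      rcases hx with rfl | ⟨n, hn, hx⟩
      · simpa using hy
      · rcases hy with rfl | ⟨m, hm, hy⟩
        · exact Or.inr ⟨n, hn, by simpa using hx⟩
        · exact Or.inr ⟨n + m, by omega, by simp [hx, hy]⟩
  exact ⟨h₀, fun β hβ => (key β hβ.2).resolve_left hβ.1.1⟩

/-- Strong induction on height: a positive even root that is not simple is a sum of two of smaller
height. -/
theorem apply_eq_zero_of_simple (hL : IsBasicClassical L) {z : T.𝔥}
    (hz : ∀ α ∈ T.evenSimpleRoots, α z = 0) {β : Module.Dual ℂ T.𝔥} (hβ : β ∈ T.posEvenRoots) :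
    β z = 0 := by
  obtain ⟨h₀, hh⟩ := exists_height (T := T) hL
  obtain ⟨n, hn, hβn⟩ := hh β hβ.2
  induction n using Nat.strong_induction_on generalizing β with
  | _ n ih =>
    by_cases hs : β ∈ T.evenSimpleRoots
    · exact hz β hs
    · have : ∃ γ ∈ T.posEvenRoots, ∃ δ ∈ T.posEvenRoots, β = γ + δ := by
        by_contra! hc
        exact hs ⟨hβ, hc⟩
      obtain ⟨γ, hγ, δ, hδ, rfl⟩ := this
      obtain ⟨a, ha, hγa⟩ := hh γ hγ.2
      obtain ⟨b, hb, hδb⟩ := hh δ hδ.2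
      have hab : n = a + b := by
        rw [LinearMap.add_apply, hγa, hδb] at hβn
        exact_mod_cast hβn.symm
      rw [LinearMap.add_apply, ih a (by omega) hγ ha hγa, ih b (by omega) hδ hb hδb, add_zero]

/-- On a weight vector, `(ad e)^k` shifts the weight by `kβ`. Choosing `h` with `β(h) ≠ 0`, the
resulting values on `h` are distinct, while `ad h` has finitely many eigenvalues. -/
theorem sbr_locally_nilpotent (hL : IsBasicClassical L) {β : Module.Dual ℂ T.𝔥} (hβ : β ≠ 0) {e : L}
    (he : e ∈ evenSpace T.𝔥 β) : IsLocallyNilpotent (sbr e : Module.End ℂ L) := by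
  have := hL.finite
  obtain ⟨h, hh⟩ := DFunLike.ne_iff.mp hβ
  intro x
  have hx : x ∈ ⨆ α, rootSpace T.𝔥 α := iSup_rootSpace (T := T) hL.simple ▸ Submodule.mem_top
  induction hx using Submodule.iSup_induction' with
  | mem γ x hx =>
    have hmem : ∀ k : ℕ, ((sbr e : Module.End ℂ L) ^ k) x ∈ rootSpace T.𝔥 (γ + k • β) := by
      intro k
      induction k with
      | zero => simpa using hx
      | succ k ih =>
        rw [pow_succ', Module.End.mul_apply, succ_nsmul, ← add_assoc, add_comm]
        exact sbr_mem_rootSpace he ih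
    have hinj : Function.Injective fun k : ℕ => γ h + k * β h := by
      intro k l hkl
      exact_mod_cast mul_right_cancel₀ hh (add_left_cancel hkl)
    obtain ⟨_, ⟨k, rfl⟩, hk⟩ := (Set.infinite_range_of_injective hinj).exists_notMem_finite
      (Module.End.finite_hasEigenvalue (sbr ((h : Even L) : L) : Module.End ℂ L))
    refine ⟨k, ?_⟩
    by_contra h0
    refine hk (Module.End.hasEigenvalue_of_hasEigenvector
      (Module.End.hasEigenvector_iff.mpr ⟨Module.End.mem_eigenspace_iff.mpr ?_, h0⟩))
    rw [hmem k h]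
    simp
  | zero => exact ⟨0, by simp⟩
  | add x y _ _ hx hy =>
    obtain ⟨n, hn⟩ := hx
    obtain ⟨m, hm⟩ := hy
    exact ⟨max n m, by rw [map_add, pow_apply_eq_zero_of_le hn (le_max_left _ _),
      pow_apply_eq_zero_of_le hm (le_max_right _ _), add_zero]⟩

end Triangular

end Structure

end LieSuperalgebra

/-! ### Coroots and generation of the even part -/

namespace LieSuperalgebra

namespace Triangular

variable {L : Type*} [AddCommGroup L] [Module ℂ L] [LieSuperalgebra L] {T : Triangular L}

/-- All positive even roots vanish on `z`; so do the negative ones, since the form pairs a nonzero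
vector of weight `-β` with one of weight `β`. -/
theorem sbr_even_eq_zero_of_simple (hL : IsBasicClassical L) {z : T.𝔥}
    (hz : ∀ α ∈ T.evenSimpleRoots, α z = 0) {w : L} (hw : w ∈ gr (L := L) 0) :
    sbr ((z : Even L) : L) w = 0 := by
  obtain ⟨B, hB⟩ := hL.exists_evenForm
  have hpos : ∀ β ∈ posRoots T.𝔥 T.Δ, ∀ x ∈ evenSpace T.𝔥 β, x ≠ 0 → β z = 0 := fun β hβ x hx hx0 =>
    apply_eq_zero_of_simple hL hz
      ⟨⟨hβ.1.1, fun h => hx0 ((Submodule.mem_bot ℂ).mp (h ▸ hx))⟩, hβ⟩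
  have key : gr (L := L) 0 ≤ LinearMap.ker (sbr ((z : Even L) : L)) := by
    refine T.even_le.trans (sup_le (sup_le (iSup₂_le fun β hβ x hx => ?_) ?_)
      (iSup₂_le fun β hβ x hx => ?_))
    · by_cases hx0 : x = 0
      · rw [hx0]; exact zero_mem _
      obtain ⟨y, hy, hxy⟩ := exists_form_ne_zero hL.simple hB hx hx0
      rw [neg_neg] at hy
      have hy0 : y ≠ 0 := fun h => hxy (by rw [h, map_zero])
      rw [LinearMap.mem_ker, hx.1 z, LinearMap.neg_apply, hpos β hβ y hy hy0, neg_zero, zero_smul]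
    · rintro _ ⟨w, hw, rfl⟩
      exact cartan_sbr_cartan hL.simple z ⟨w, hw⟩
    · by_cases hx0 : x = 0
      · rw [hx0]; exact zero_mem _
      rw [LinearMap.mem_ker, hx.1 z, hpos β hβ x hx hx0, zero_smul]
  exact key hw

variable (T) in
/-- The span of the brackets `[L_0^α, L_0^{-α}]` for the simple roots `α` of `L_0`. -/
def corootSpan : Submodule ℂ (gr (L := L) 0) :=
  Submodule.span ℂ {u | ∃ α ∈ T.evenSimpleRoots, ∃ x ∈ evenSpace T.𝔥 α, ∃ y ∈ evenSpace T.𝔥 (-α),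
    sbr x y = (u : L)}

theorem exists_sum_of_mem_corootSpan {u : gr (L := L) 0} (hu : u ∈ T.corootSpan) :
    ∃ (n : ℕ) (α : Fin n → Module.Dual ℂ T.𝔥) (x y : Fin n → L),
      (∀ i, α i ∈ T.evenSimpleRoots ∧ x i ∈ evenSpace T.𝔥 (α i) ∧ y i ∈ evenSpace T.𝔥 (-α i)) ∧
      (u : L) = ∑ i, sbr (x i) (y i) := by
  obtain ⟨n, c, g, rfl⟩ := Submodule.mem_span_set'.mp hu
  choose α hα x hx y hy hxy using fun i => (g i).2
  refine ⟨n, α, fun i => c i • x i, y, fun i => ⟨hα i, Submodule.smul_mem _ _ (hx i), hy i⟩, ?_⟩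
  simp [hxy]

theorem exists_cartan_of_mem_corootSpan (hL : IsBasicClassical L) {u : gr (L := L) 0}
    (hu : u ∈ T.corootSpan) : ∃ t : T.𝔥, (u : L) = ((t : Even L) : L) := by
  obtain ⟨B, hB⟩ := hL.exists_evenForm
  have : T.corootSpan ≤ T.𝔥.toSubmodule := by
    refine Submodule.span_le.mpr ?_
    rintro u ⟨α, -, x, hx, y, hy, hxy⟩
    obtain ⟨t, ht, -⟩ := exists_cartan_eq_sbr hB hx hy
    have hut : u = (t : Even L) := Subtype.ext (hxy.symm.trans ht)
    rw [hut]
    exact t.2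
  exact ⟨⟨u, this hu⟩, rfl⟩

/-- This splits `h` into a part in the coroot span and a part centralising `L_0`, so that `ad h`
becomes a sum of commutators on `L_0`. -/
theorem exists_add_of_cartan (hL : IsBasicClassical L) (h : T.𝔥) :
    ∃ t ∈ T.corootSpan, ∀ w ∈ gr (L := L) 0, sbr ((h : Even L) : L) w = sbr (t : L) w := by
  have := hL.finite
  obtain ⟨B, hB⟩ := hL.exists_evenForm
  set B₀ := B.restrict (gr (L := L) 0) with hB₀
  have hrefl : B₀.IsRefl := by
    intro x y hxy
    exact (hB.symm y y.2 x x.2).trans hxy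
  have horth : ∀ a : T.𝔥, ((a : Even L) : gr (L := L) 0) ∈ B₀.orthogonal T.corootSpan →
      ∀ w ∈ gr (L := L) 0, sbr ((a : Even L) : L) w = 0 := by
    intro a ha w hw
    refine sbr_even_eq_zero_of_simple hL (fun α hα => ?_) hw
    obtain ⟨x, hx, hx0⟩ := Submodule.exists_mem_ne_zero_of_ne_bot hα.1.1.2
    obtain ⟨y, hy, hxy⟩ := exists_form_ne_zero hL.simple hB hx hx0
    obtain ⟨t, ht, htB⟩ := exists_cartan_eq_sbr hB hx hy
    have h1 : B ((t : Even L) : L) ((a : Even L) : L) = 0 :=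
      LinearMap.BilinForm.mem_orthogonal_iff.mp ha (t : Even L)
        (Submodule.subset_span ⟨α, hα, x, hx, y, hy, ht⟩)
    rw [htB a] at h1
    exact (mul_eq_zero.mp h1).resolve_right hxy
  -- The form is non-degenerate on the coroot span: an element of the span orthogonal to it
  -- centralises `L_0`, and is then zero by `cartan_eq_zero_of_sum`.
  have hcompl : IsCompl T.corootSpan (B₀.orthogonal T.corootSpan) := by
    rw [LinearMap.BilinForm.isCompl_orthogonal_iff_disjoint hrefl, Submodule.disjoint_def]
    intro u hu hu'
    obtain ⟨a, ha⟩ := exists_cartan_of_mem_corootSpan hL hu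
    obtain rfl : u = (a : Even L) := Subtype.ext ha
    obtain ⟨n, α, x, y, hxy, hsum⟩ := exists_sum_of_mem_corootSpan hu
    have h0 := horth a hu'
    rw [cartan_eq_zero_of_sum hL Finset.univ (fun i _ => (hxy i).2.1.2) (fun i _ => (hxy i).2.2.2)
      (fun i _ => h0 _ (hxy i).2.1.2) (fun i _ => h0 _ (hxy i).2.2.2) hsum]
    rfl
  obtain ⟨t, ht, z, hz, htz⟩ := Submodule.mem_sup.mp
    (hcompl.sup_eq_top ▸ Submodule.mem_top : (h : Even L) ∈ T.corootSpan ⊔ B₀.orthogonal T.corootSpan)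
  refine ⟨t, ht, fun w hw => ?_⟩
  obtain ⟨a, ha⟩ := exists_cartan_of_mem_corootSpan hL ht
  have hza : z = ((h - a : T.𝔥) : Even L) := by
    refine Subtype.ext ?_
    have : (t : L) + (z : L) = ((h : Even L) : L) := congrArg Subtype.val htz
    rw [ha] at this
    exact eq_sub_of_add_eq' this
  have h0 := horth (h - a) (hza ▸ hz) w hw
  rw [← hza] at h0
  have : ((h : Even L) : L) = (t : L) + (z : L) := (congrArg Subtype.val htz).symm
  rw [this, map_add, LinearMap.add_apply, h0, add_zero]

theorem form_eq_zero_of_mem_iSup {B : LinearMap.BilinForm ℂ L} (hB : IsEvenForm B)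
    {S S' : Set (Module.Dual ℂ T.𝔥)} {f g : Module.Dual ℂ T.𝔥 → Module.Dual ℂ T.𝔥}
    (h : ∀ α ∈ S, ∀ β ∈ S', f α + g β ≠ 0) {x y : L} (hx : x ∈ ⨆ α ∈ S, evenSpace T.𝔥 (f α))
    (hy : y ∈ ⨆ β ∈ S', evenSpace T.𝔥 (g β)) : B x y = 0 := by
  have h1 : (⨆ α ∈ S, evenSpace T.𝔥 (f α)) ≤ LinearMap.ker (B.flip y) := by
    refine iSup₂_le fun α hα u hu => ?_
    have h2 : (⨆ β ∈ S', evenSpace T.𝔥 (g β)) ≤ LinearMap.ker (B u) :=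
      iSup₂_le fun β hβ w hw => form_eq_zero hB (h α hα β hβ) hu hw
    exact h2 hy
  exact h1 hx

/-- A subspace of the even part which contains the Cartan subalgebra and the positive root spaces, and
which is stable under the positive and the negative simple root spaces, is the even part. -/
theorem even_le_of_stable (hL : IsBasicClassical L) {P : Submodule ℂ L} (hP : P ≤ gr 0)
    (hc : cartanSubmodule T.𝔥 ≤ P)
    (hpos : ∀ β ∈ T.posEvenRoots, evenSpace T.𝔥 β ≤ P)
    (hpos' : ∀ β ∈ T.posEvenRoots, ∀ e ∈ evenSpace T.𝔥 β, ∀ p ∈ P, sbr e p ∈ P)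
    (hneg' : ∀ α ∈ T.evenSimpleRoots, ∀ e ∈ evenSpace T.𝔥 (-α), ∀ p ∈ P, sbr e p ∈ P) :
    gr (L := L) 0 ≤ P := by
  have := hL.finite
  obtain ⟨B, hB⟩ := hL.exists_evenForm
  obtain ⟨h₀, hh⟩ := exists_height (T := T) hL
  -- The orthogonal complement of `P` in `L_0`; by invariance it inherits the stability properties
  -- of `P`.
  let N : Submodule ℂ L :=
    { carrier := {z | z ∈ gr (L := L) 0 ∧ ∀ p ∈ P, B z p = 0}
      add_mem' := fun hx hy => ⟨add_mem hx.1 hy.1, fun p hp => by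
        rw [map_add, LinearMap.add_apply, hx.2 p hp, hy.2 p hp, add_zero]⟩
      zero_mem' := ⟨zero_mem _, fun p _ => by simp⟩
      smul_mem' := fun c x hx => ⟨Submodule.smul_mem _ _ hx.1, fun p hp => by
        rw [map_smul, LinearMap.smul_apply, hx.2 p hp, smul_zero]⟩ }
  have hNst : ∀ e ∈ gr (L := L) 0, (∀ p ∈ P, sbr e p ∈ P) → ∀ z ∈ N, sbr e z ∈ N := by
    intro e he hep z hz
    refine ⟨sbr_even_mem he hz.1, fun p hp => ?_⟩
    rw [sbr_skew_of_even he, map_neg, LinearMap.neg_apply, hB.inv, hz.2 _ (hep p hp), neg_zero]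
  have hempty : ∀ β ∈ posRoots T.𝔥 T.Δ, ∀ x ∈ evenSpace T.𝔥 β, x ≠ 0 → β ∈ T.posEvenRoots :=
    fun β hβ x hx hx0 => ⟨⟨hβ.1.1, fun h => hx0 ((Submodule.mem_bot ℂ).mp (h ▸ hx))⟩, hβ⟩
  -- `P` contains the Cartan subalgebra and the positive part. Orthogonality to the positive part
  -- removes the negative component of `z`, and orthogonality to the Cartan subalgebra removes the
  -- Cartan component.
  have hNle : N ≤ ⨆ α ∈ posRoots T.𝔥 T.Δ, evenSpace T.𝔥 α := by
    intro z hz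
    obtain ⟨y, hy, zp, hzp, rfl⟩ := Submodule.mem_sup.mp (T.even_le hz.1)
    obtain ⟨zn, hzn, zc, hzc, rfl⟩ := Submodule.mem_sup.mp hy
    have hposroot : ∀ β ∈ posRoots T.𝔥 T.Δ, ∀ γ ∈ posRoots T.𝔥 T.Δ, β + γ ≠ 0 := by
      intro β hβ γ hγ h0
      obtain ⟨n, hn, hβn⟩ := hh β hβ
      obtain ⟨m, hm, hγm⟩ := hh γ hγ
      have : (β + γ) h₀ = 0 := by rw [h0, LinearMap.zero_apply]
      rw [LinearMap.add_apply, hβn, hγm] at this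
      have : n + m = 0 := by exact_mod_cast this
      omega
    have hpne : ∀ β ∈ posRoots T.𝔥 T.Δ, ∀ γ ∈ ({0} : Set (Module.Dual ℂ T.𝔥)), β + γ ≠ 0 := by
      rintro β hβ _ rfl
      simpa using hβ.1.1
    have hnne : ∀ β ∈ posRoots T.𝔥 T.Δ, ∀ γ ∈ ({0} : Set (Module.Dual ℂ T.𝔥)), -β + γ ≠ 0 := by
      rintro β hβ _ rfl
      simpa using hβ.1.1
    have hC : cartanSubmodule T.𝔥 ≤ ⨆ α ∈ ({0} : Set (Module.Dual ℂ T.𝔥)), evenSpace T.𝔥 α := by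
      simpa using cartanSubmodule_le (T := T) hL.simple
    have hcc : ∀ {x y : L}, x ∈ cartanSubmodule T.𝔥 →
        y ∈ (⨆ α ∈ posRoots T.𝔥 T.Δ, evenSpace T.𝔥 α) → B x y = 0 := fun hx hy =>
      form_eq_zero_of_mem_iSup hB (f := id) (g := id)
        (fun γ hγ β hβ => by rw [add_comm]; exact hpne β hβ γ hγ) (hC hx) hy
    have hPN : (⨆ α ∈ posRoots T.𝔥 T.Δ, evenSpace T.𝔥 α) ≤ P := iSup₂_le fun β hβ x hx => by
      by_cases hx0 : x = 0
      · rw [hx0]; exact zero_mem _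
      · exact hpos β (hempty β hβ x hx hx0) hx
    have hzn0 : zn ∈ gr (L := L) 0 :=
      (iSup₂_le fun _ _ => inf_le_right : (⨆ α ∈ posRoots T.𝔥 T.Δ, evenSpace T.𝔥 (-α)) ≤ gr 0) hzn
    have hzc0 : zc ∈ gr (L := L) 0 := (cartanSubmodule_le (T := T) hL.simple hzc).2
    have hz1 : zn = 0 := by
      refine hB.nondeg zn hzn0 fun u hu => ?_
      obtain ⟨y, hy, up, hup, rfl⟩ := Submodule.mem_sup.mp (T.even_le hu)
      obtain ⟨un, hun, uc, huc, rfl⟩ := Submodule.mem_sup.mp hy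
      have h1 : B zn un = 0 := form_eq_zero_of_mem_iSup hB (f := Neg.neg) (g := Neg.neg)
        (fun β hβ γ hγ => by rw [← neg_add]; exact neg_ne_zero.mpr (hposroot β hβ γ hγ)) hzn hun
      have h2 : B zn uc = 0 := form_eq_zero_of_mem_iSup hB (f := Neg.neg) (g := id) hnne hzn (hC huc)
      have h3 : B zp up = 0 := form_eq_zero_of_mem_iSup hB (f := id) (g := id) hposroot hzp hup
      have h4 := hz.2 up (hPN hup)
      rw [map_add, map_add, LinearMap.add_apply, LinearMap.add_apply, h3, hcc hzc hup, add_zero,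
        add_zero] at h4
      rw [map_add, map_add, h1, h2, h4, add_zero, add_zero]
    have hz2 : zc = 0 := by
      refine hB.nondeg zc hzc0 fun u hu => ?_
      obtain ⟨y, hy, up, hup, rfl⟩ := Submodule.mem_sup.mp (T.even_le hu)
      obtain ⟨un, hun, uc, huc, rfl⟩ := Submodule.mem_sup.mp hy
      have h1 : B zc un = 0 := form_eq_zero_of_mem_iSup hB (f := id) (g := Neg.neg)
        (fun γ hγ β hβ => by rw [add_comm]; exact hnne β hβ γ hγ) (hC hzc) hun
      have h2 : B zp uc = 0 := form_eq_zero_of_mem_iSup hB (f := id) (g := id) hpne hzp (hC huc)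
      have h4 := hz.2 uc (hc huc)
      rw [hz1, zero_add, map_add, LinearMap.add_apply, h2, add_zero] at h4
      rw [map_add, map_add, h1, h4, hcc hzc hup, add_zero, add_zero]
    rwa [hz1, hz2, add_zero, zero_add]
  have hN : N = ⊥ := by
    by_contra hN0
    have : Nontrivial N := Submodule.nontrivial_iff_ne_bot.mpr hN0
    obtain ⟨t, ht, hth⟩ := exists_add_of_cartan hL h₀
    obtain ⟨n, α, x, y, hxy, hsum⟩ := exists_sum_of_mem_corootSpan ht
    have hX : ∀ i, ∀ w ∈ N, sbr (x i) w ∈ N := fun i =>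
      hNst _ (hxy i).2.1.2 (hpos' _ (hxy i).1.1 _ (hxy i).2.1)
    have hY : ∀ i, ∀ w ∈ N, sbr (y i) w ∈ N := fun i =>
      hNst _ (hxy i).2.2.2 (hneg' _ (hxy i).1 _ (hxy i).2.2)
    have hf : ∀ w ∈ N, sbr ((h₀ : Even L) : L) w
        = ∑ i, (sbr (x i) (sbr (y i) w) - sbr (y i) (sbr (x i) w)) := by
      intro w hw
      rw [hth w hw.1, hsum, map_sum, LinearMap.sum_apply]
      refine Finset.sum_congr rfl fun i _ => ?_
      rw [sbr_jacobi_of_even (hxy i).2.1.2 (hxy i).2.2.2, add_sub_cancel_right]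
    have hfN : ∀ w ∈ N, sbr ((h₀ : Even L) : L) w ∈ N := fun w hw => by
      rw [hf w hw]
      exact sum_mem fun i _ => sub_mem (hX i _ (hY i w hw)) (hY i _ (hX i w hw))
    refine trace_ne_zero_of_eigenvalues (LinearMap.restrict (sbr ((h₀ : Even L) : L)) hfN) ?_
      (trace_restrict_eq_zero_of_commutators N Finset.univ (X := fun i => sbr (x i))
        (Y := fun i => sbr (y i)) hfN (fun i _ => hX i) (fun i _ => hY i) hf)
    intro c hc
    obtain ⟨w, hw⟩ := hc.exists_hasEigenvector
    have hw1 := congrArg Subtype.val hw.apply_eq_smul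
    -- If `c` is not a positive integer, then `w` lies in the sum of the eigenspaces for other
    -- eigenvalues, which is independent of the one for `c`.
    by_contra hcn
    refine hw.2 (Subtype.ext (Submodule.disjoint_def.mp
      (Module.End.eigenspaces_iSupIndep (sbr ((h₀ : Even L) : L) : Module.End ℂ L) c) _
        (Module.End.mem_eigenspace_iff.mpr hw1) ?_))
    refine (show (⨆ α ∈ posRoots T.𝔥 T.Δ, evenSpace T.𝔥 α) ≤ _ from
      iSup₂_le fun β hβ u hu => ?_) (hNle w.2)
    obtain ⟨n, hn, hβn⟩ := hh β hβ
    have hne : β h₀ ≠ c := fun h => hcn ⟨n, hn, h ▸ hβn⟩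
    exact (le_iSup₂ (f := fun j (_ : j ≠ c) =>
      Module.End.eigenspace (sbr ((h₀ : Even L) : L) : Module.End ℂ L) j) (β h₀) hne)
        (Module.End.mem_eigenspace_iff.mpr (hu.1 h₀))
  -- A functional vanishing on `P` but not on `v` is represented through the form by an element of
  -- `N = 0`.
  by_contra hle
  obtain ⟨v, hv, hvP⟩ := SetLike.not_le_iff_exists.mp hle
  obtain ⟨φ, h1, h2⟩ := Submodule.exists_le_ker_of_notMem hvP
  have hnd : (B.restrict (gr (L := L) 0)).Nondegenerate :=
    ⟨fun x hx => Subtype.ext (hB.nondeg x x.2 fun y hy => hx ⟨y, hy⟩),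
      fun x hx => Subtype.ext (hB.nondeg x x.2 fun y hy => (hB.symm x x.2 y hy).trans (hx ⟨y, hy⟩))⟩
  set z := ((B.restrict (gr (L := L) 0)).toDual hnd).symm (φ ∘ₗ (gr (L := L) 0).subtype) with hz
  have hzφ : ∀ u : gr (L := L) 0, B z u = φ u := fun u =>
    LinearMap.BilinForm.apply_toDual_symm_apply (hB := hnd) (φ ∘ₗ (gr (L := L) 0).subtype) u
  have hzN : (z : L) ∈ N := ⟨z.2, fun p hp => (hzφ ⟨p, hP hp⟩).trans (h2 hp)⟩
  rw [hN, Submodule.mem_bot] at hzN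
  refine h1 ?_
  rw [← hzφ ⟨v, hv⟩, hzN, map_zero, LinearMap.zero_apply]

end Triangular

end LieSuperalgebra

/-! ### Local finiteness of the action on a cyclic module -/

namespace LieSuperalgebra

section Modules

variable {L : Type*} [AddCommGroup L] [Module ℂ L] [LieSuperalgebra L]
  {V : Type*} [AddCommGroup V] [Module ℂ V]

/-- The compatibility of a linear map `L → End V` with the superbracket. -/
def IsSuperAction (ρ : L →ₗ[ℂ] Module.End ℂ V) : Prop :=
  ∀ {i j : ZMod 2} {x y : L}, x ∈ gr (L := L) i → y ∈ gr (L := L) j →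
    ρ (sbr x y) = ρ x * ρ y - superSign i j • (ρ y * ρ x)

/-- The vector `v` generates `V` under the operators `ρ x`. -/
def IsCyclicVector (ρ : L →ₗ[ℂ] Module.End ℂ V) (v : V) : Prop :=
  ∀ W : Submodule ℂ V, v ∈ W → (∀ x : L, ∀ w ∈ W, ρ x w ∈ W) → W = ⊤

variable {ρ : L →ₗ[ℂ] Module.End ℂ V} {v : V}

theorem IsSuperAction.map_sbr_of_even (hρ : IsSuperAction ρ) {x : L} (hx : x ∈ gr (L := L) 0)
    (y : L) : ρ (sbr x y) = ρ x * ρ y - ρ y * ρ x := by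
  obtain ⟨a, ha, b, hb, rfl⟩ := exists_even_add_odd y
  have h1 := hρ hx ha
  have h2 := hρ hx hb
  simp only [superSign, ZMod.val_zero, zero_mul, pow_zero, one_smul] at h1 h2
  rw [map_add, map_add, map_add, h1, h2, mul_add, add_mul]
  abel

theorem IsSuperAction.apply_apply (hρ : IsSuperAction ρ) {x : L} (hx : x ∈ gr (L := L) 0)
    (y : L) (w : V) : ρ x (ρ y w) = ρ (sbr x y) w + ρ y (ρ x w) := by
  rw [hρ.map_sbr_of_even hx, LinearMap.sub_apply, Module.End.mul_apply, Module.End.mul_apply,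
    sub_add_cancel]

theorem IsSuperAction.map_pow_sbr (hρ : IsSuperAction ρ) {e : L} (he : e ∈ gr (L := L) 0) (x : L)
    (k : ℕ) : ρ (((sbr e : Module.End ℂ L) ^ k) x) = ((commutatorMap (ρ e)) ^ k) (ρ x) := by
  induction k with
  | zero => simp
  | succ k ih =>
    rw [pow_succ', pow_succ', Module.End.mul_apply, Module.End.mul_apply, hρ.map_sbr_of_even he, ih]
    simp [commutatorMap]

/-- If `U` is finite-dimensional and stable under `x`, so is the span of `L U`. Hence the vectors
lying in such subspaces form a submodule, and it contains `v`. -/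
theorem IsSuperAction.isLocallyFinite (hρ : IsSuperAction ρ) [Module.Finite ℂ L]
    (hv : IsCyclicVector ρ v) {x : L} (hx : x ∈ gr (L := L) 0) {U : Submodule ℂ V} (hvU : v ∈ U)
    (hU : U.FG) (hst : ∀ u ∈ U, ρ x u ∈ U) : IsLocallyFinite (ρ x) := by
  let W : Submodule ℂ V :=
    { carrier := {w | ∃ U : Submodule ℂ V, w ∈ U ∧ U.FG ∧ ∀ u ∈ U, ρ x u ∈ U}
      add_mem' := by
        rintro a b ⟨U, h1, h2, h3⟩ ⟨U', h1', h2', h3'⟩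
        refine ⟨U ⊔ U', Submodule.add_mem_sup h1 h1', h2.sup h2', fun u hu => ?_⟩
        obtain ⟨c, hc, d, hd, rfl⟩ := Submodule.mem_sup.mp hu
        rw [map_add]
        exact Submodule.add_mem_sup (h3 c hc) (h3' d hd)
      zero_mem' := ⟨⊥, zero_mem _, Submodule.fg_bot, by simp⟩
      smul_mem' := fun c a ⟨U, h1, h2, h3⟩ => ⟨U, U.smul_mem c h1, h2, h3⟩ }
  have hW : W = ⊤ := by
    refine hv W ⟨U, hvU, hU, hst⟩ ?_
    rintro y w ⟨U, h1, h2, h3⟩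
    refine ⟨Submodule.map₂ ρ ⊤ U, Submodule.apply_mem_map₂ ρ Submodule.mem_top h1,
      Submodule.FG.map₂ ρ Module.Finite.fg_top h2, fun u hu => ?_⟩
    have : Submodule.map₂ ρ ⊤ U ≤ (Submodule.map₂ ρ ⊤ U).comap (ρ x) := by
      refine Submodule.map₂_le.mpr fun z _ u hu => ?_
      rw [Submodule.mem_comap, hρ.apply_apply hx]
      exact add_mem (Submodule.apply_mem_map₂ ρ Submodule.mem_top hu)
        (Submodule.apply_mem_map₂ ρ Submodule.mem_top (h3 u hu))
    exact this hu
  intro w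
  exact (hW ▸ Submodule.mem_top : w ∈ W)

/-- By the Leibniz rule each factor `e` falls on `x` or on `w`. The bound `K + N` is one more than
needed, which keeps the induction uniform. -/
theorem IsSuperAction.pow_apply_eq_zero (hρ : IsSuperAction ρ) {e : L} (he : e ∈ gr (L := L) 0)
    (s : ℕ) : ∀ (K N : ℕ) (x : L) (w : V), K + N = s → ((sbr e : Module.End ℂ L) ^ K) x = 0 →
      ((ρ e) ^ N) w = 0 → ((ρ e) ^ s) (ρ x w) = 0 := by
  induction s with
  | zero =>
    intro K N x w h hK _
    obtain rfl : K = 0 := by omega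
    rw [show x = 0 by simpa using hK]
    simp
  | succ s ih =>
    intro K N x w h hK hN
    rw [pow_succ, Module.End.mul_apply, hρ.apply_apply he, map_add]
    have h1 : ((ρ e) ^ s) (ρ (sbr e x) w) = 0 := by
      rcases K with _ | K
      · rw [show x = 0 by simpa using hK]
        simp
      · exact ih K N (sbr e x) w (by omega) (by rwa [pow_succ, Module.End.mul_apply] at hK) hN
    have h2 : ((ρ e) ^ s) (ρ x (ρ e w)) = 0 := by
      rcases N with _ | N
      · rw [show w = 0 by simpa using hN]
        simp
      · exact ih K N x (ρ e w) (by omega) hK (by rwa [pow_succ, Module.End.mul_apply] at hN)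
    rw [h1, h2, add_zero]

theorem IsSuperAction.isLocallyNilpotent (hρ : IsSuperAction ρ) (hv : IsCyclicVector ρ v) {e : L}
    (he : e ∈ gr (L := L) 0) (had : IsLocallyNilpotent (sbr e : Module.End ℂ L)) {n : ℕ}
    (hn : ((ρ e) ^ n) v = 0) : IsLocallyNilpotent (ρ e) := by
  let W : Submodule ℂ V :=
    { carrier := {w | ∃ n : ℕ, ((ρ e) ^ n) w = 0}
      add_mem' := fun {a b} ⟨n, hn⟩ ⟨m, hm⟩ => ⟨max n m, by
        rw [map_add, pow_apply_eq_zero_of_le hn (le_max_left _ _),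
          pow_apply_eq_zero_of_le hm (le_max_right _ _), add_zero]⟩
      zero_mem' := ⟨0, by simp⟩
      smul_mem' := fun c a ⟨n, hn⟩ => ⟨n, by rw [map_smul, hn, smul_zero]⟩ }
  have hW : W = ⊤ := by
    refine hv W ⟨n, hn⟩ ?_
    rintro x w ⟨N, hN⟩
    obtain ⟨K, hK⟩ := had x
    exact ⟨K + N, hρ.pow_apply_eq_zero he (K + N) K N x w rfl hK hN⟩
  intro w
  exact (hW ▸ Submodule.mem_top : w ∈ W)

/-- The span of the even elements which act locally finitely. -/
def locallyFiniteSpan (ρ : L →ₗ[ℂ] Module.End ℂ V) : Submodule ℂ L :=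
  Submodule.span ℂ {x | x ∈ gr (L := L) 0 ∧ IsLocallyFinite (ρ x)}

/-- For every `s`, `exp(s ad e) x` acts as a conjugate of `x`, so it lies in the span; the
coefficient of `s` in this polynomial curve is `[e, x]`. -/
theorem IsSuperAction.sbr_mem_locallyFiniteSpan (hρ : IsSuperAction ρ) {e : L}
    (he : e ∈ gr (L := L) 0) (had : IsLocallyNilpotent (sbr e : Module.End ℂ L))
    (hnil : IsLocallyNilpotent (ρ e)) {x : L} (hx : x ∈ locallyFiniteSpan ρ) :
    sbr e x ∈ locallyFiniteSpan ρ := by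
  induction hx using Submodule.span_induction with
  | mem x hx =>
    obtain ⟨hx0, hxf⟩ := hx
    obtain ⟨K₀, hK₀⟩ := had x
    -- At least `2`, so that the linear coefficient is among the terms of the sum.
    set K := max K₀ 2 with hK
    have hKx := pow_apply_eq_zero_of_le hK₀ (le_max_left K₀ 2)
    have heven : ∀ k : ℕ, ((sbr e : Module.End ℂ L) ^ k) x ∈ gr (L := L) 0 := by
      intro k
      induction k with
      | zero => simpa using hx0
      | succ k ih =>
        rw [pow_succ', Module.End.mul_apply]
        exact sbr_even_mem he ih
    have key := coeff_mem_of_forall_sum_mem (locallyFiniteSpan ρ) (K := K)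
      (fun k => ((k.factorial : ℂ)⁻¹) • ((sbr e : Module.End ℂ L) ^ k) x) ?_
      (k := 1) (by omega)
    · simpa using key
    · intro s
      refine Submodule.subset_span ⟨sum_mem fun k _ =>
        Submodule.smul_mem _ _ (Submodule.smul_mem _ _ (heven k)), ?_⟩
      have hse : ∀ k : ℕ, ((commutatorMap (ρ (s • e))) ^ k) (ρ x)
          = s ^ k • ρ (((sbr e : Module.End ℂ L) ^ k) x) := by
        intro k
        rw [← hρ.map_pow_sbr (Submodule.smul_mem _ s he), map_smul, smul_pow, LinearMap.smul_apply,
          map_smul]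
      have hnil' : IsLocallyNilpotent (ρ (s • e)) := by
        intro w
        obtain ⟨n, hn⟩ := hnil w
        exact ⟨n, by rw [map_smul, smul_pow, LinearMap.smul_apply, hn, smul_zero]⟩
      have := hxf.exp_conj hnil' (K := K) (by rw [hse, hKx, map_zero, smul_zero])
      convert this using 1
      rw [map_sum]
      refine Finset.sum_congr rfl fun k _ => ?_
      rw [hse, map_smul, map_smul, smul_comm]
  | zero => simp
  | add x y _ _ hx hy => rw [map_add]; exact add_mem hx hy
  | smul c x _ hx => rw [map_smul]; exact Submodule.smul_mem _ _ hx

theorem IsSuperAction.finite_of_even_le (hρ : IsSuperAction ρ) [Module.Finite ℂ L]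
    (hv : IsCyclicVector ρ v) (hF : gr (L := L) 0 ≤ locallyFiniteSpan ρ) : Module.Finite ℂ V := by
  have hFle : locallyFiniteSpan ρ ≤ gr 0 := Submodule.span_le.mpr fun x hx => hx.1
  obtain ⟨s, hs, hspan⟩ := (Submodule.fg_span_iff_fg_span_finset_subset _).mp
    (IsNoetherian.noetherian (locallyFiniteSpan ρ))
  obtain ⟨s', hs'⟩ := IsNoetherian.noetherian (gr (L := L) 1)
  classical
  set S := s ∪ s' with hS
  let u : Fin S.card → L := fun i => (S.equivFin.symm i : L)
  have hrange : Set.range u = (S : Set L) := by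
    ext x
    constructor
    · rintro ⟨i, rfl⟩
      exact (S.equivFin.symm i).2
    · intro hx
      exact ⟨S.equivFin ⟨x, hx⟩, by simp [u]⟩
  have htop : Submodule.span ℂ (Set.range u) = ⊤ := by
    rw [hrange, hS, Finset.coe_union, Submodule.span_union, hs', ← hspan, eq_top_iff,
      ← (isCompl_gr (L := L)).sup_eq_top]
    exact sup_le_sup_right hF _
  have hmem : ∀ x : L, ρ x ∈ Submodule.span ℂ (Set.range fun i => ρ (u i)) := by
    intro x
    have : Submodule.span ℂ (Set.range fun i => ρ (u i)) = (Submodule.span ℂ (Set.range u)).map ρ := by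
      rw [Submodule.map_span, ← Set.range_comp]
      rfl
    rw [this, htop]
    exact ⟨x, trivial, rfl⟩
  have hodd : ∀ i, (u i ∈ gr (L := L) 0 ∧ IsLocallyFinite (ρ (u i))) ∨ u i ∈ gr (L := L) 1 := by
    intro i
    have : u i ∈ S := (S.equivFin.symm i).2
    rcases Finset.mem_union.mp this with h | h
    · exact Or.inl (hs h)
    · exact Or.inr (hs' ▸ Submodule.subset_span h)
  have hgr : ∀ i, ∃ j : ZMod 2, u i ∈ gr (L := L) j := fun i =>
    (hodd i).elim (fun h => ⟨0, h.1⟩) (fun h => ⟨1, h⟩)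
  refine finite_of_cyclic (b := fun i => ρ (u i)) (v := v) ?_ ?_ ?_
  · intro W hvW hW
    refine hv W hvW fun x w hw => ?_
    have hx : x ∈ Submodule.span ℂ (Set.range u) := htop ▸ Submodule.mem_top
    induction hx using Submodule.span_induction with
    | mem x hx =>
      obtain ⟨i, rfl⟩ := hx
      exact hW i w hw
    | zero => simp
    | add x y _ _ hx hy => rw [map_add]; exact add_mem hx hy
    | smul c x _ hx => rw [map_smul]; exact Submodule.smul_mem _ _ hx
  · intro i j
    obtain ⟨a, ha⟩ := hgr i
    obtain ⟨c, hc⟩ := hgr j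
    exact ⟨superSign a c, hρ ha hc ▸ hmem _⟩
  · intro i
    refine (hodd i).imp (fun h => h.2) fun h => ?_
    -- For odd `u` the sign is `-1`, so `[u, u]` acts as `2 u²`.
    have h1 := hρ h h
    have h2 : superSign 1 1 = -1 := by simp [superSign, ZMod.val_one]
    rw [h2, neg_smul, one_smul, sub_neg_eq_add, ← two_smul ℂ] at h1
    have h3 : ρ (u i) * ρ (u i) = ρ ((2 : ℂ)⁻¹ • sbr (u i) (u i)) := by
      rw [map_smul, h1, smul_smul, inv_mul_cancel₀ two_ne_zero, one_smul]
    rw [h3]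
    exact hmem _

/-- A module generated by a highest weight vector which is killed by a power of each negative simple
even root vector is finite-dimensional. -/
theorem IsSuperAction.finite_of_highestWeight (hL : IsBasicClassical L) {T : Triangular L}
    (hρ : IsSuperAction ρ) (hv : IsCyclicVector ρ v) (hpos : ∀ x ∈ nPos T.𝔥 T.Δ, ρ x v = 0)
    {lam : Module.Dual ℂ T.𝔥} (hlam : ∀ h : T.𝔥, ρ ((h : Even L) : L) v = lam h • v)
    (hneg : ∀ α ∈ T.evenSimpleRoots, ∀ (x y : L) (h : T.𝔥), T.IsRootTriple α x y h →
      ∃ n : ℕ, ((ρ y) ^ n) v = 0) : Module.Finite ℂ V := by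
  have := hL.finite
  have hposnil : ∀ β ∈ T.posEvenRoots, ∀ e ∈ evenSpace T.𝔥 β, IsLocallyNilpotent (ρ e) := by
    intro β hβ e he
    refine hρ.isLocallyNilpotent hv he.2 (Triangular.sbr_locally_nilpotent hL hβ.1.1 he) (n := 1) ?_
    rw [pow_one]
    exact hpos e (le_iSup₂ (f := fun α (_ : α ∈ posRoots T.𝔥 T.Δ) => rootSpace T.𝔥 α) β hβ.2 he.1)
  refine hρ.finite_of_even_le hv (Triangular.even_le_of_stable (T := T) hL ?_ ?_ ?_ ?_ ?_)
  · exact Submodule.span_le.mpr fun x hx => hx.1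
  · rintro _ ⟨h, hh, rfl⟩
    refine Submodule.subset_span ⟨h.2, hρ.isLocallyFinite hv h.2
      (Submodule.mem_span_singleton_self v) (Submodule.fg_span_singleton v) fun u hu => ?_⟩
    obtain ⟨c, rfl⟩ := Submodule.mem_span_singleton.mp hu
    have h1 := hlam ⟨h, hh⟩
    rw [map_smul, Submodule.subtype_apply, h1]
    exact Submodule.smul_mem _ _ (Submodule.smul_mem _ _ (Submodule.mem_span_singleton_self v))
  · intro β hβ e he
    exact Submodule.subset_span ⟨he.2, (hposnil β hβ e he).isLocallyFinite⟩
  · intro β hβ e he p hp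
    exact hρ.sbr_mem_locallyFiniteSpan he.2 (Triangular.sbr_locally_nilpotent hL hβ.1.1 he)
      (hposnil β hβ e he) hp
  · intro α hα e he p hp
    by_cases he0 : e = 0
    · rw [he0, map_zero, LinearMap.zero_apply]
      exact zero_mem _
    -- Every nonzero vector of weight `-α` is the negative member of a root triple, so the power
    -- relation applies to it.
    obtain ⟨x, h, hx⟩ := Triangular.exists_rootTriple hL hα.1.1.1 he he0
    obtain ⟨n, hn⟩ := hneg α hα x e h hx
    have had := Triangular.sbr_locally_nilpotent hL (neg_ne_zero.mpr hα.1.1.1) he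
    exact hρ.sbr_mem_locallyFiniteSpan he.2 had (hρ.isLocallyNilpotent hv he.2 had hn) hp

end Modules

/-! ### The enveloping superalgebra and the module `V̄(lam)` -/

section Vbar

variable {L : Type*} [AddCommGroup L] [Module ℂ L] [LieSuperalgebra L] {T : Triangular L}

/-- The highest weight vector of the finite-dimensional irreducible module is primitive for the
`sl₂` of the root triple, so its weight is a natural number. -/
theorem Triangular.exists_nat_of_dominant {lam : Module.Dual ℂ T.𝔥} (hlam : lam ∈ T.dominantWeights)
    {α : Module.Dual ℂ T.𝔥} (hα : α ∈ T.evenSimpleRoots) {x y : L} {h : T.𝔥}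
    (ht : T.IsRootTriple α x y h) : ∃ n : ℕ, lam h = n := by
  obtain ⟨V, _, _, ρ, -, ⟨v, hv⟩, _⟩ := hlam
  -- `IsSl2Triple` requires a nonzero middle element; if `h` acts by zero, then `lam h = 0`.
  by_cases h0 : ρ.act ((h : Even L) : L) = 0
  · refine ⟨0, ?_⟩
    have := hv.cartan_act h
    rw [h0, LinearMap.zero_apply] at this
    simpa [hv.ne_zero] using this.symm
  have hsbr : ∀ a ∈ gr (L := L) 0, ∀ b ∈ gr (L := L) 0,
      ρ.act a * ρ.act b - ρ.act b * ρ.act a = ρ.act (sbr a b) := by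
    intro a ha b hb
    ext w
    simp [ρ.act_sbr ha hb, superSign]
  let _ : LieRing (Module.End ℂ V) := LieRing.ofAssociativeRing
  have triple : IsSl2Triple (ρ.act ((h : Even L) : L)) (ρ.act x) (ρ.act y) := by
    refine ⟨h0, ?_, ?_, ?_⟩
    · rw [LieRing.of_associative_ring_bracket, hsbr _ ht.pos_mem.2 _ ht.neg_mem.2, ht.sbr_eq]
    · rw [LieRing.of_associative_ring_bracket, hsbr _ h.1.2 _ ht.pos_mem.2, ht.pos_mem.1 h,
        ht.apply_eq_two, map_smul, ← Nat.cast_smul_eq_nsmul ℂ, Nat.cast_ofNat]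
    · rw [LieRing.of_associative_ring_bracket, hsbr _ h.1.2 _ ht.neg_mem.2, ht.neg_mem.1 h,
        LinearMap.neg_apply, ht.apply_eq_two, map_smul, neg_smul, ← Nat.cast_smul_eq_nsmul ℂ,
        Nat.cast_ofNat]
  have prim : triple.HasPrimitiveVectorWith v (lam h) :=
    ⟨hv.ne_zero, hv.cartan_act h, hv.nPos_act x
      (le_iSup₂ (f := fun α (_ : α ∈ posRoots T.𝔥 T.Δ) => rootSpace T.𝔥 α) α hα.1.2 ht.pos_mem.1)⟩
  exact prim.exists_nat

variable (L) in
/-- The canonical map from the tensor algebra to the enveloping superalgebra. -/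
noncomputable def tensorToU : TensorAlgebra ℂ L →ₐ[ℂ] Enveloping L :=
  RingQuot.mkAlgHom ℂ (EnvelopingRel L)

theorem tensorToU_surjective : Function.Surjective (tensorToU L) :=
  RingQuot.mkAlgHom_surjective ℂ (EnvelopingRel L)

theorem toU_sbr {i j : ZMod 2} {x y : L} (hx : x ∈ gr (L := L) i) (hy : y ∈ gr (L := L) j) :
    toU L (sbr x y) = toU L x * toU L y - superSign i j • (toU L y * toU L x) := by
  have : tensorToU L _ = tensorToU L _ := RingQuot.mkAlgHom_rel ℂ (EnvelopingRel.rel hx hy)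
  rwa [map_sub, map_smul, map_mul, map_mul] at this

section EnvelopingModule

variable {V : Type*} [AddCommGroup V] [Module ℂ V] [Module (Enveloping L) V]
  [IsScalarTower ℂ (Enveloping L) V]

theorem smul_mem_of_toU_smul_mem (W : Submodule ℂ V)
    (hW : ∀ x : L, ∀ w ∈ W, toU L x • w ∈ W) (u : Enveloping L) {w : V} (hw : w ∈ W) : u • w ∈ W := by
  obtain ⟨a, rfl⟩ := tensorToU_surjective u
  induction a using TensorAlgebra.induction generalizing w with
  | algebraMap c =>
    rw [AlgHom.commutes, algebraMap_smul]
    exact W.smul_mem c hw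
  | ι x => exact hW x w hw
  | mul a b ha hb =>
    rw [map_mul, mul_smul]
    exact ha (hb hw)
  | add a b ha hb =>
    rw [map_add, add_smul]
    exact add_mem (ha hw) (hb hw)

variable (L V) in
/-- The action of `L` on a module over its enveloping superalgebra. -/
noncomputable def envelopingAction : L →ₗ[ℂ] Module.End ℂ V :=
  (Algebra.lsmul ℂ ℂ V : Enveloping L →ₐ[ℂ] Module.End ℂ V).toLinearMap ∘ₗ toU L

theorem envelopingAction_apply (x : L) (w : V) : envelopingAction L V x w = toU L x • w := rfl

theorem envelopingAction_pow_apply (x : L) (k : ℕ) (w : V) :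
    ((envelopingAction L V x) ^ k) w = (toU L x ^ k) • w := by
  induction k with
  | zero => simp
  | succ k ih =>
    rw [pow_succ', pow_succ', Module.End.mul_apply, ih, envelopingAction_apply, mul_smul]

theorem isSuperAction_envelopingAction : IsSuperAction (envelopingAction L V) := by
  intro i j x y hx hy
  ext w
  simp only [envelopingAction_apply, toU_sbr hx hy, sub_smul, mul_smul, smul_assoc,
    LinearMap.sub_apply, LinearMap.smul_apply, Module.End.mul_apply]

theorem isCyclicVector_envelopingAction {v : V} (hv : ∀ w : V, ∃ u : Enveloping L, u • v = w) :
    IsCyclicVector (envelopingAction L V) v := by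
  intro W hvW hW
  rw [eq_top_iff]
  rintro w -
  obtain ⟨u, rfl⟩ := hv w
  exact smul_mem_of_toU_smul_mem W hW u hvW

theorem Triangular.finite_of_vbarIdeal_smul (hL : IsBasicClassical L) {lam : Module.Dual ℂ T.𝔥}
    (hlam : lam ∈ T.dominantWeights) {v : V} (hv : ∀ w : V, ∃ u : Enveloping L, u • v = w)
    (hkill : ∀ u ∈ T.vbarIdeal lam, u • v = 0) : Module.Finite ℂ V := by
  refine isSuperAction_envelopingAction.finite_of_highestWeight hL
    (isCyclicVector_envelopingAction hv) (T := T) (lam := lam) ?_ ?_ ?_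
  · intro x hx
    exact hkill _ (Submodule.subset_span (Or.inl (Or.inl ⟨x, hx, rfl⟩)))
  · intro h
    have := hkill _ (Submodule.subset_span (Or.inl (Or.inr ⟨h, rfl⟩)))
    rwa [sub_smul, sub_eq_zero, algebraMap_smul] at this
  · intro α hα x y h ht
    -- The ideal contains a power of `y` only when `lam h` is a natural number; dominance guarantees
    -- this for every root triple.
    obtain ⟨n, hn⟩ := Triangular.exists_nat_of_dominant hlam hα ht
    refine ⟨n + 1, ?_⟩
    rw [envelopingAction_pow_apply]
    exact hkill _ (Submodule.subset_span (Or.inr ⟨α, hα, x, y, h, n, ht, hn, rfl⟩))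

end EnvelopingModule

theorem Triangular.finite_vbar (hL : IsBasicClassical L) {lam : Module.Dual ℂ T.𝔥}
    (hlam : lam ∈ T.dominantWeights) : Module.Finite ℂ (T.Vbar lam) := by
  refine Triangular.finite_of_vbarIdeal_smul hL hlam
    (v := (Submodule.Quotient.mk 1 : Enveloping L ⧸ T.vbarIdeal lam)) (fun w => ?_) fun u hu => ?_
  · obtain ⟨u, rfl⟩ := Submodule.Quotient.mk_surjective _ w
    exact ⟨u, by rw [← Submodule.Quotient.mk_smul, smul_eq_mul, mul_one]⟩
  · rw [← Submodule.Quotient.mk_smul, Submodule.Quotient.mk_eq_zero, smul_eq_mul, mul_one]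
    exact hu

end Vbar

end LieSuperalgebra

theorem mainTheorem6 {L : Type*} [AddCommGroup L] [Module ℂ L] [LieSuperalgebra L]
    (hL : LieSuperalgebra.IsBasicClassical L)
    {Γ : Type*} [Group Γ] [Finite Γ] (A : LieSuperalgebra.GroupAction Γ L)
    (hfix : LieSuperalgebra.IsBasicClassical A.fixed)
    (T : LieSuperalgebra.Triangular A.fixed)
    (lam : Module.Dual ℂ T.𝔥) (hlam : lam ∈ T.dominantWeights) :
    Module.Finite ℂ (T.Vbar lam) :=
  LieSuperalgebra.Triangular.finite_vbar hfix hlam
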